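/- Let $\mathbb{T}=\mathbb{R}\cup\{-\infty\}$ with $a\oplus b=\max\{a,b\}$, $a\odot b=a+b$ and $a\oslash b=a-b$ ($b\ne-\infty$). A tropical (Laurent) polynomial $f=\bigoplus_{\mathbf i\in\mathbb{Z}^n}c_{\mathbf i}\mathbf x^{\mathbf i}$, with finitely many $c_{\mathbf i}\neq-\infty$, defines the function $f(\mathbf t)=\max_{\mathbf i}(c_{\mathbf i}+\mathbf i\cdot\mathbf t)$ on $\mathbb{R}^n$, and $\mathrm{Newt}(f)$ is the convex hull of $\{\mathbf i: c_{\mathbf i}\ne-\infty\}$. An expression of a function $\varphi:\mathbb{R}^n\to\mathbb{T}$ is a pair $(f,g)$ of tropical polynomials, $g\neq-\infty$, with $\varphi=f\oslash g$ as functions; its volume $\mathrm{vol}(f,g)$ is the $(n+1)$-dimensional volume of $\mathrm{Newt}(f\oplus(x_{n+1}\odot g))$. The monomial complexity $\mathrm{mComp}(f)$ is the number of linear regions (maximal connected open sets on which the function is affine) of the function defined by $f$; for a sequence $f_1,\dots,f_m$ ($m\ge1$) of tropical polynomials, $\mathrm{fComp}(f_1,\dots,f_m)=\sum_{i=1}^m\mathrm{mComp}(f_i)-(m-1)$.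 A factorization of $f$ is a sequence with $f=f_1\odot\cdots\odot f_m$ as functions. Pairs of sequences are preordered by $(F;G)\le(F';G')$ if $\mathrm{fComp}(F)\le\mathrm{fComp}(F')$ and $\mathrm{fComp}(G)\le\mathrm{fComp}(G')$, and $(F;G)<(F';G')$ means $(F;G)\le(F';G')$ but not $(F';G')\le(F;G)$. In two variables let $f_1=x^2\oplus xy\oplus y^2\oplus x\oplus y$, $g_1=xy\oplus x\oplus y$ and $\varphi=f_1\oslash g_1$. Then: 1. $(f_1,g_1)$ has minimum volume among all expressions of $\varphi$, and $\mathrm{vol}(f_1,g_1)=7/6$. 2. It is the unique expression of minimum volume, as functions and up to a common monomial: if $(f,g)$ is an expression of $\varphi$ of minimum volume, there are $\mathbf i\in\mathbb{Z}^2$ and $c\in\mathbb{R}$ such that $f=c\,\mathbf x^{\mathbf i}\odot f_1$ and $g=c\,\mathbf x^{\mathbf i}\odot g_1$ as functions. 3. No pair of factorizations of the numerator and the denominator of a minimum volume expression of $\varphi$ has the smallest factorization complexity. More precisely, with $f_2=x^2\oplus xy\oplus y^2\oplus x\oplus y\oplus 0$ one has $\varphi=f_2\oslash\big((x\oplus0)\odot(y\oplus0)\big)$,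 and $(f_2;\,x\oplus0,\,y\oplus0)<(F;G)$ for every expression $(f,g)$ of $\varphi$ of minimum volume, every factorization $F$ of $f$ and every factorization $G$ of $g$. -/

import Mathlib

open MeasureTheory

noncomputable section

namespace TropRat

/-- The max-plus tropical semifield `ℝ ∪ {-∞}`. Mathlib's `Tropical` is min-plus, so the order of `ℝ`
is reversed: the formal top element is `-∞`, `+` is the maximum and `*` is the usual sum.
In particular `0 : Trop` is `-∞` and `1 : Trop` is the real number `0`. -/
abbrev Trop : Type := Tropical (WithTop ℝᵒᵈ)

/-- The inclusion `ℝ ⊆ ℝ ∪ {-∞}`. -/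
def ofReal (a : ℝ) : Trop := Tropical.trop ((OrderDual.toDual a : ℝᵒᵈ) : WithTop ℝᵒᵈ)

theorem ofReal_add_ofReal (a b : ℝ) : ofReal a + ofReal b = ofReal (max a b) := by
  rcases le_total a b with h | h
  · rw [max_eq_right h]
    exact Tropical.add_eq_right (WithTop.coe_le_coe.2 (OrderDual.toDual_le_toDual.2 h))
  · rw [max_eq_left h]
    exact Tropical.add_eq_left (WithTop.coe_le_coe.2 (OrderDual.toDual_le_toDual.2 h))

theorem ofReal_mul_ofReal (a b : ℝ) : ofReal a * ofReal b = ofReal (a + b) := rfl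

theorem ofReal_div_ofReal (a b : ℝ) : ofReal a / ofReal b = ofReal (a - b) := rfl

theorem zero_div_ofReal (b : ℝ) : (0 : Trop) / ofReal b = 0 := rfl

/-- Tropical Laurent polynomials in `n` variables, as formal expressions. The polynomial all of whose
coefficients are `-∞` is `0`. -/
abbrev TropPoly (n : ℕ) : Type := AddMonoidAlgebra Trop (Fin n → ℤ)

/-- The variable `x_k`. -/
def var {n : ℕ} (k : Fin n) : TropPoly n := AddMonoidAlgebra.single (Pi.single k 1) 1

/-- The function `ℝⁿ → ℝ ∪ {-∞}` defined by a tropical polynomial,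
`t ↦ max_i (c_i + i_1 t_1 + ⋯ + i_n t_n)`. -/
def eval {n : ℕ} (f : TropPoly n) (t : Fin n → ℝ) : Trop :=
  ∑ i ∈ f.coeff.support, f.coeff i * ofReal (∑ k, (i k : ℝ) * t k)

/-- The function `f ⊘ g` from `ℝⁿ` to `ℝ ∪ {-∞}`; it is only used for `g ≠ -∞`. -/
def quot {n : ℕ} (f g : TropPoly n) (t : Fin n → ℝ) : Trop := eval f t / eval g t

/-- `φ = f ⊘ g` is an expression of the function `φ`. -/
def IsExpression {n : ℕ} (φ : (Fin n → ℝ) → Trop) (f g : TropPoly n) : Prop :=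
  g ≠ 0 ∧ φ = quot f g

/-- The Newton polytope: the convex hull of the exponents whose coefficient is not `-∞`. -/
def newt {n : ℕ} (f : TropPoly n) : Set (Fin n → ℝ) :=
  convexHull ℝ ((fun (i : Fin n → ℤ) (k : Fin n) => (i k : ℝ)) '' (f.coeff.support : Set (Fin n → ℤ)))

/-- A polynomial in `x_1, …, x_n`, regarded as a polynomial in `x_1, …, x_{n+1}`. -/
def lift {n : ℕ} (f : TropPoly n) : TropPoly (n + 1) :=
  AddMonoidAlgebra.mapDomain (fun i : Fin n → ℤ => (Fin.snoc i 0 : Fin (n + 1) → ℤ)) f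

/-- The volume of the pair `(f, g)`: the Lebesgue measure of the Newton polytope of
`f ⊕ (x_{n+1} ⊙ g)`. This is `0` when that polytope is not full-dimensional. -/
def vol {n : ℕ} (f g : TropPoly n) : ℝ :=
  (volume : Measure (Fin (n + 1) → ℝ)).real (newt (lift f + var (Fin.last n) * lift g))

/-- `φ = f ⊘ g` is an expression of `φ` of minimum volume. -/
def IsMinVolExpression {n : ℕ} (φ : (Fin n → ℝ) → Trop) (f g : TropPoly n) : Prop :=
  IsExpression φ f g ∧ ∀ f' g' : TropPoly n, IsExpression φ f' g' → vol f g ≤ vol f' g'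

/-- `F` is affine on `U` (or identically `-∞` on `U`). -/
def IsAffineOn {n : ℕ} (F : (Fin n → ℝ) → Trop) (U : Set (Fin n → ℝ)) : Prop :=
  (∃ a : (Fin n → ℝ) →ᵃ[ℝ] ℝ, ∀ t ∈ U, F t = ofReal (a t)) ∨ ∀ t ∈ U, F t = 0

/-- A linear region of `F`: a maximal connected open set on which `F` is affine. -/
def IsLinearRegion {n : ℕ} (F : (Fin n → ℝ) → Trop) (U : Set (Fin n → ℝ)) : Prop :=
  Maximal (fun W => IsOpen W ∧ IsConnected W ∧ IsAffineOn F W) U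

/-- The monomial complexity: the number of linear regions of the function defined by `f`. -/
def mComp {n : ℕ} (f : TropPoly n) : ℕ := {U | IsLinearRegion (eval f) U}.ncard

/-- The factorization complexity of a sequence `f_1, …, f_m`: `∑ mComp f_i - (m - 1)`. -/
def fComp {n : ℕ} (L : List (TropPoly n)) : ℤ := (L.map fun f => (mComp f : ℤ)).sum - (L.length - 1)

/-- `f = f_1 ⊙ ⋯ ⊙ f_m` as functions, with `m ≥ 1`. -/
def IsFactorization {n : ℕ} (f : TropPoly n) (L : List (TropPoly n)) : Prop :=
  L ≠ [] ∧ eval f = eval L.prod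

/-- The preorder comparing the factorization complexities of numerator and denominator. -/
def FCompLE {n : ℕ} (p q : List (TropPoly n) × List (TropPoly n)) : Prop :=
  fComp p.1 ≤ fComp q.1 ∧ fComp p.2 ≤ fComp q.2

/-- The strict part of `FCompLE`. -/
def FCompLT {n : ℕ} (p q : List (TropPoly n) × List (TropPoly n)) : Prop :=
  FCompLE p q ∧ ¬ FCompLE q p

end TropRat

end

noncomputable section

namespace TropRat

open Filter Topology

/-! Structure of expressions. If `f = g + φ` as functions and `φ` is positively homogeneous, growth
along rays shows that the support functions of the Newton polygons of `f` and `g` differ by `φ`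
(`pair_eq_pair_add`). Here `φ` is linear on five cones, and moving a direction inside a cone shows
that the corresponding corners of the two polygons differ by the integral slope of `φ` there
(`exists_isCorner`). Comparing corners, the polygon of `g` has a vertical right edge and a
horizontal top edge, so it has width at least 1 in direction (1,1), and the upper antidiagonal edge
of `f` is two steps longer than that of `g`. By integrality there are three cases: width at least 2;
width 1 with a nontrivial upper antidiagonal edge; or the unit triangle of `xy, x, y`. In the first
two, explicit tetrahedra already fill volume 4/3; in the third the polytope is a translate of that
of `(f₁, g₁)`, of volume 7/6 (`le_vol_or_exists_isMinSupport`, `IsMinSupport.vol_eq`). There,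
comparing dominant monomials along rays forces equal coefficients, hence uniqueness.

Complexity. On a line, a maximum of `m` affine functions has at most `m - 1` break points, and a
break point of a product is one of some factor. So `fComp` of any factorization exceeds the number
of break points on any line (`card_lt_fComp`). Suitable lines give the lower bounds 4 for `f₁` and 3
for `g₁`, up to monomials, whereas `f₂` and `x ⊕ 0, y ⊕ 0` each have complexity at most 3. -/

/-! ### Tropical polynomials as maxima of real affine functions. -/

theorem ofReal_ne_zero (a : ℝ) : ofReal a ≠ 0 := Tropical.trop_coe_ne_zero _

theorem ofReal_injective : Function.Injective ofReal := fun _ _ h =>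
  OrderDual.toDual.injective (WithTop.coe_injective (Tropical.trop_injective h))

/-- The real number underlying an element of `ℝ ∪ {-∞}`, with value `0` at `-∞`. -/
def toReal (a : Trop) : ℝ := OrderDual.ofDual ((Tropical.untrop a).untopD (OrderDual.toDual 0))

@[simp] theorem toReal_ofReal (a : ℝ) : toReal (ofReal a) = a := rfl

theorem ofReal_toReal {a : Trop} (h : a ≠ 0) : ofReal (toReal a) = a := by
  have h' : Tropical.untrop a ≠ ⊤ := fun h0 => h (Tropical.untrop_injective h0)
  obtain ⟨b, hb⟩ := WithTop.ne_top_iff_exists.1 h'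
  have : a = ofReal (OrderDual.ofDual b) := Tropical.untrop_injective hb.symm
  rw [this, toReal_ofReal]

theorem one_eq_ofReal : (1 : Trop) = ofReal 0 := rfl

theorem sum_ofReal {ι : Type*} {s : Finset ι} (hs : s.Nonempty) (a : ι → ℝ) :
    ∑ i ∈ s, ofReal (a i) = ofReal (s.sup' hs a) := by
  induction hs using Finset.Nonempty.cons_induction with
  | singleton i => simp
  | cons i s hi hs ih =>
    rw [Finset.sum_cons, ih, ofReal_add_ofReal, Finset.sup'_cons hs]

/-- The pairing `i_1 t_1 + ⋯ + i_n t_n` of an exponent and a point. -/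
def pair {n : ℕ} (i : Fin n → ℤ) (t : Fin n → ℝ) : ℝ := ∑ k, (i k : ℝ) * t k

theorem pair_add_left {n : ℕ} (i j : Fin n → ℤ) (t : Fin n → ℝ) :
    pair (i + j) t = pair i t + pair j t := by
  simp [pair, add_mul, Finset.sum_add_distrib]

theorem pair_add_right {n : ℕ} (i : Fin n → ℤ) (t u : Fin n → ℝ) :
    pair i (t + u) = pair i t + pair i u := by
  simp [pair, mul_add, Finset.sum_add_distrib]

theorem pair_smul_right {n : ℕ} (i : Fin n → ℤ) (s : ℝ) (t : Fin n → ℝ) :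
    pair i (s • t) = s * pair i t := by
  simp only [pair, Finset.mul_sum, Pi.smul_apply, smul_eq_mul]
  exact Finset.sum_congr rfl fun _ _ => by ring

theorem pair_fin_two (i : Fin 2 → ℤ) (t : Fin 2 → ℝ) : pair i t = i 0 * t 0 + i 1 * t 1 := by
  simp [pair, Fin.sum_univ_two]

/-- Evaluation at a point as a homomorphism of semirings. -/
def evalHom {n : ℕ} (t : Fin n → ℝ) : TropPoly n →ₐ[Trop] Trop :=
  AddMonoidAlgebra.lift Trop Trop (Fin n → ℤ)
    { toFun := fun i => ofReal (pair i.toAdd t)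
      map_one' := by simp [pair, one_eq_ofReal]
      map_mul' := fun i j => by rw [ofReal_mul_ofReal, toAdd_mul, pair_add_left] }

theorem eval_eq_evalHom {n : ℕ} (f : TropPoly n) (t : Fin n → ℝ) : eval f t = evalHom t f := by
  rw [evalHom, AddMonoidAlgebra.lift_apply]
  rfl

theorem eval_add {n : ℕ} (f g : TropPoly n) (t : Fin n → ℝ) :
    eval (f + g) t = eval f t + eval g t := by simp [eval_eq_evalHom]

theorem eval_mul {n : ℕ} (f g : TropPoly n) (t : Fin n → ℝ) :
    eval (f * g) t = eval f t * eval g t := by simp [eval_eq_evalHom]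

theorem eval_zero {n : ℕ} (t : Fin n → ℝ) : eval (0 : TropPoly n) t = 0 := by
  simp [eval_eq_evalHom]

theorem eval_one {n : ℕ} (t : Fin n → ℝ) : eval (1 : TropPoly n) t = ofReal 0 := by
  rw [eval_eq_evalHom, map_one, one_eq_ofReal]

theorem eval_single {n : ℕ} (i : Fin n → ℤ) (c : Trop) (t : Fin n → ℝ) :
    eval (AddMonoidAlgebra.single i c) t = c * ofReal (pair i t) := by
  rw [eval_eq_evalHom, evalHom, AddMonoidAlgebra.lift_single]
  rfl

theorem eval_var {n : ℕ} (k : Fin n) (t : Fin n → ℝ) : eval (var k) t = ofReal (t k) := by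
  rw [var, eval_single, one_eq_ofReal, ofReal_mul_ofReal]
  congr 1
  simp [pair, Pi.single_apply]

/-- `H` is the pointwise maximum of the functions `l i`, `i ∈ E`. -/
def IsMaxOf {ι X : Type*} (E : Finset ι) (l : ι → X → ℝ) (H : X → ℝ) : Prop :=
  ∀ t, (∀ i ∈ E, l i t ≤ H t) ∧ ∃ i ∈ E, H t = l i t

/-- The affine function `c_i + i_1 t_1 + ⋯ + i_n t_n` defined by the `i`-th monomial of `f`. -/
def monomialMap {n : ℕ} (f : TropPoly n) (i : Fin n → ℤ) (t : Fin n → ℝ) : ℝ :=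
  toReal (f.coeff i) + pair i t

/-- The real valued function defined by a tropical polynomial `f ≠ -∞`. -/
def realEval {n : ℕ} (f : TropPoly n) (t : Fin n → ℝ) : ℝ := toReal (eval f t)

theorem support_nonempty {n : ℕ} {f : TropPoly n} (hf : f ≠ 0) : f.coeff.support.Nonempty := by
  rw [Finsupp.support_nonempty_iff]
  simpa using hf

theorem eval_eq_sup' {n : ℕ} {f : TropPoly n} (hf : f ≠ 0) (t : Fin n → ℝ) :
    eval f t = ofReal (f.coeff.support.sup' (support_nonempty hf) fun i => monomialMap f i t) := by
  rw [← sum_ofReal, eval]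
  refine Finset.sum_congr rfl fun i hi => ?_
  rw [monomialMap, ← ofReal_mul_ofReal, ofReal_toReal (Finsupp.mem_support_iff.1 hi)]
  rfl

theorem eval_eq_ofReal {n : ℕ} {f : TropPoly n} (hf : f ≠ 0) (t : Fin n → ℝ) :
    eval f t = ofReal (realEval f t) := by
  rw [realEval, eval_eq_sup' hf, toReal_ofReal]

theorem eval_ne_zero {n : ℕ} {f : TropPoly n} (hf : f ≠ 0) (t : Fin n → ℝ) : eval f t ≠ 0 := by
  rw [eval_eq_ofReal hf]
  exact ofReal_ne_zero _

theorem ne_zero_of_eval_ne_zero {n : ℕ} {f : TropPoly n} {t : Fin n → ℝ} (h : eval f t ≠ 0) :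
    f ≠ 0 := by
  rintro rfl
  exact h (eval_zero t)

theorem realEval_eq_of_eval_eq {n : ℕ} {f : TropPoly n} {t : Fin n → ℝ} {a : ℝ}
    (h : eval f t = ofReal a) : realEval f t = a := by rw [realEval, h, toReal_ofReal]

theorem isMaxOf_realEval {n : ℕ} {f : TropPoly n} (hf : f ≠ 0) :
    IsMaxOf f.coeff.support (monomialMap f) (realEval f) := by
  intro t
  rw [realEval, eval_eq_sup' hf, toReal_ofReal]
  refine ⟨fun i hi => Finset.le_sup' (fun i => monomialMap f i t) hi, ?_⟩
  obtain ⟨i, hi, h⟩ := Finset.exists_mem_eq_sup' (support_nonempty hf) (fun i => monomialMap f i t)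
  exact ⟨i, hi, h⟩

/-! ### Volumes of tetrahedra and of unions separated by a plane. -/

/-- The corner simplex `{x | 0 ≤ x_i, ∑ x_i ≤ r}` in `ℝⁿ`. -/
def cornerSimplex (n : ℕ) (r : ℝ) : Set (Fin n → ℝ) := {x | (∀ i, 0 ≤ x i) ∧ ∑ i, x i ≤ r}

theorem isClosed_cornerSimplex (n : ℕ) (r : ℝ) : IsClosed (cornerSimplex n r) := by
  have : cornerSimplex n r = (⋂ i, {x | 0 ≤ x i}) ∩ {x | ∑ i, x i ≤ r} := by
    ext x; simp [cornerSimplex]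
  rw [this]
  exact (isClosed_iInter fun i => isClosed_le continuous_const (continuous_apply i)).inter
    (isClosed_le (by fun_prop) continuous_const)

/-- Slicing by the first coordinate `a` leaves a corner simplex of size `r - a`, so the volume is
the integral of `(r - a)^n / n!` over `[0, r]`. -/
theorem volume_cornerSimplex (n : ℕ) : ∀ r : ℝ, 0 ≤ r →
    volume (cornerSimplex n r) = ENNReal.ofReal (r ^ n / n.factorial) := by
  induction n with
  | zero =>
    intro r hr
    have : cornerSimplex 0 r = Set.univ := by ext x; simp [cornerSimplex, hr]
    rw [this, volume_pi, Measure.pi_of_empty]; simp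
  | succ n ih =>
    intro r hr
    have hmp := (volume_preserving_piFinSuccAbove (fun _ : Fin (n + 1) => ℝ) 0).symm
    rw [← hmp.measure_preimage (isClosed_cornerSimplex _ r).measurableSet.nullMeasurableSet]
    rw [Measure.volume_eq_prod, Measure.prod_apply
      (hmp.measurable (isClosed_cornerSimplex _ r).measurableSet)]
    have hslice : ∀ a : ℝ, volume (Prod.mk a ⁻¹'
        ((MeasurableEquiv.piFinSuccAbove (fun _ : Fin (n + 1) => ℝ) 0).symm ⁻¹'
          cornerSimplex (n + 1) r)) =
        (Set.Icc 0 r).indicator (fun a => ENNReal.ofReal ((r - a) ^ n / n.factorial)) a := by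
      intro a
      by_cases ha : a ∈ Set.Icc 0 r
      · rw [Set.indicator_of_mem ha, ← ih (r - a) (sub_nonneg.2 ha.2)]
        congr 1
        ext x
        simp [cornerSimplex, MeasurableEquiv.piFinSuccAbove, Fin.forall_fin_succ,
          Fin.sum_univ_succ, ha.1, le_sub_iff_add_le']
      · rw [Set.indicator_of_notMem ha]
        convert measure_empty (μ := (volume : Measure (Fin n → ℝ)))
        rw [Set.eq_empty_iff_forall_notMem]
        rintro x ⟨h0, h1⟩
        refine ha ⟨by simpa [MeasurableEquiv.piFinSuccAbove] using h0 0, ?_⟩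
        rw [Fin.sum_univ_succ] at h1
        have h2 : 0 ≤ ∑ i : Fin n, (MeasurableEquiv.piFinSuccAbove
            (fun _ : Fin (n + 1) => ℝ) 0).symm (a, x) i.succ :=
          Finset.sum_nonneg fun i _ => h0 _
        have h3 : (MeasurableEquiv.piFinSuccAbove
            (fun _ : Fin (n + 1) => ℝ) 0).symm (a, x) 0 = a := by
          simp [MeasurableEquiv.piFinSuccAbove]
        linarith
    simp_rw [hslice]
    rw [lintegral_indicator measurableSet_Icc, ← ofReal_integral_eq_lintegral_ofReal]
    · congr 1
      rw [integral_Icc_eq_integral_Ioc, ← intervalIntegral.integral_of_le hr,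
        intervalIntegral.integral_div,
        intervalIntegral.integral_comp_sub_left (fun x => x ^ n) r]
      simp [Nat.factorial_succ]
      field_simp
    · exact (Continuous.integrableOn_Icc (by fun_prop))
    · filter_upwards [ae_restrict_mem measurableSet_Icc] with a ha
      have := sub_nonneg.2 ha.2
      positivity

/-- The tetrahedron with vertices `a`, `b`, `c`, `d`. -/
def tetra (a b c d : Fin 3 → ℝ) : Set (Fin 3 → ℝ) := convexHull ℝ {a, b, c, d}

theorem tetra_subset {a b c d : Fin 3 → ℝ} {K : Set (Fin 3 → ℝ)} (hK : Convex ℝ K)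
    (ha : a ∈ K) (hb : b ∈ K) (hc : c ∈ K) (hd : d ∈ K) : tetra a b c d ⊆ K := by
  refine convexHull_min ?_ hK
  rintro x (rfl | rfl | rfl | rfl) <;> assumption

theorem isCompact_tetra (a b c d : Fin 3 → ℝ) : IsCompact (tetra a b c d) :=
  Set.Finite.isCompact_convexHull ℝ (by simp)

theorem mem_tetra {a b c d x : Fin 3 → ℝ} (r s t u : ℝ) (hr : 0 ≤ r) (hs : 0 ≤ s) (ht : 0 ≤ t)
    (hu : 0 ≤ u) (h : r + s + t + u = 1) (hx : ∀ k, x k = r * a k + s * b k + t * c k + u * d k) :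
    x ∈ tetra a b c d := by
  have key := (convex_convexHull ℝ ({a, b, c, d} : Set (Fin 3 → ℝ))).sum_mem
    (t := Finset.univ) (w := ![r, s, t, u]) (z := ![a, b, c, d])
    (by intro i _; fin_cases i <;> simpa) (by simpa [Fin.sum_univ_four] using h)
    (by intro i _; apply subset_convexHull; fin_cases i <;> simp)
  have hsum : x = ∑ i, ![r, s, t, u] i • ![a, b, c, d] i := by
    ext k
    simp [Fin.sum_univ_four, hx]
  rw [hsum]
  exact key

theorem tetra_eq_image (a b c d : Fin 3 → ℝ) :
    tetra a b c d = (fun x => a + x) '' (Matrix.toLin' (Matrix.of ![b - a, c - a, d - a]).transpose ''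
      cornerSimplex 3 1) := by
  have hlin : ∀ (w : Fin 3 → ℝ) (k : Fin 3),
      Matrix.toLin' (Matrix.of ![b - a, c - a, d - a]).transpose w k =
        (b k - a k) * w 0 + (c k - a k) * w 1 + (d k - a k) * w 2 := by
    intro w k
    simp [Matrix.mulVec, dotProduct, Fin.sum_univ_three]
  apply Set.Subset.antisymm
  · refine tetra_subset ?_ ?_ ?_ ?_ ?_
    · refine Convex.translate (Convex.linear_image ?_ _) a
      have : cornerSimplex 3 1 = (⋂ i, {x | 0 ≤ x i}) ∩ {x | ∑ i, x i ≤ 1} := by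
        ext x; simp [cornerSimplex]
      rw [this]
      refine (convex_iInter fun i => ?_).inter ?_
      · exact convex_halfSpace_ge (LinearMap.proj (R := ℝ) (φ := fun _ : Fin 3 => ℝ) i).isLinear 0
      · have := convex_halfSpace_le
          (∑ i, LinearMap.proj (R := ℝ) (φ := fun _ : Fin 3 => ℝ) i).isLinear 1
        simpa using this
    · refine ⟨_, ⟨0, ?_, rfl⟩, ?_⟩
      · simp [cornerSimplex]
      · ext k; simp
    · refine ⟨_, ⟨![1, 0, 0], ?_, rfl⟩, ?_⟩
      · simp [cornerSimplex, Fin.forall_fin_succ, Fin.sum_univ_three]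
      · ext k; simp only [Pi.add_apply, hlin]; simp
    · refine ⟨_, ⟨![0, 1, 0], ?_, rfl⟩, ?_⟩
      · simp [cornerSimplex, Fin.forall_fin_succ, Fin.sum_univ_three]
      · ext k; simp only [Pi.add_apply, hlin]; simp
    · refine ⟨_, ⟨![0, 0, 1], ?_, rfl⟩, ?_⟩
      · simp [cornerSimplex, Fin.forall_fin_succ, Fin.sum_univ_three]
      · ext k; simp only [Pi.add_apply, hlin]; simp
  · rintro _ ⟨_, ⟨w, ⟨hw, hs⟩, rfl⟩, rfl⟩
    rw [Fin.sum_univ_three] at hs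
    refine mem_tetra (1 - (w 0 + w 1 + w 2)) (w 0) (w 1) (w 2) (by linarith) (hw 0) (hw 1) (hw 2)
      (by ring) fun k => ?_
    simp only [Pi.add_apply, hlin]
    ring

theorem volume_real_tetra (a b c d : Fin 3 → ℝ) :
    volume.real (tetra a b c d) = |(Matrix.of ![b - a, c - a, d - a]).det| / 6 := by
  rw [measureReal_def, tetra_eq_image, Set.image_add_left, measure_preimage_add,
    Measure.addHaar_image_linearMap, LinearMap.det_toLin', Matrix.det_transpose,
    volume_cornerSimplex 3 1 zero_le_one, ENNReal.toReal_mul, ENNReal.toReal_ofReal (abs_nonneg _),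
    ENNReal.toReal_ofReal (by positivity)]
  norm_num [Nat.factorial]
  ring

theorem volume_real_tetra_eq (a₀ a₁ a₂ b₀ b₁ b₂ c₀ c₁ c₂ d₀ d₁ d₂ : ℝ) :
    volume.real (tetra ![a₀, a₁, a₂] ![b₀, b₁, b₂] ![c₀, c₁, c₂] ![d₀, d₁, d₂]) =
      |(b₀ - a₀) * ((c₁ - a₁) * (d₂ - a₂) - (c₂ - a₂) * (d₁ - a₁)) -
        (b₁ - a₁) * ((c₀ - a₀) * (d₂ - a₂) - (c₂ - a₂) * (d₀ - a₀)) +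
        (b₂ - a₂) * ((c₀ - a₀) * (d₁ - a₁) - (c₁ - a₁) * (d₀ - a₀))| / 6 := by
  rw [volume_real_tetra, Matrix.det_fin_three]
  simp
  ring_nf

theorem dotProduct_fin_three (p q r a b c : ℝ) :
    ![p, q, r] ⬝ᵥ ![a, b, c] = p * a + q * b + r * c := by
  simp [dotProduct, Fin.sum_univ_three]

theorem volume_hyperplane {n : ℕ} {p : Fin n → ℝ} (hp : p ≠ 0) (c : ℝ) :
    volume {x : Fin n → ℝ | p ⬝ᵥ x = c} = 0 := by
  obtain ⟨k, hk⟩ := Function.ne_iff.1 hp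
  let s : AffineSubspace ℝ (Fin n → ℝ) :=
    { carrier := {x | p ⬝ᵥ x = c}
      smul_vsub_vadd_mem' := by
        intro r x y z hx hy hz
        simp only [Set.mem_ofPred_eq, vsub_eq_sub, vadd_eq_add, dotProduct_add, dotProduct_smul,
          dotProduct_sub] at *
        rw [hx, hy, hz]; simp }
  have hs : s ≠ ⊤ := by
    intro h
    have h0 : (0 : Fin n → ℝ) ∈ s := h ▸ AffineSubspace.mem_top ℝ _ _
    have h1 : Pi.single k 1 ∈ s := h ▸ AffineSubspace.mem_top ℝ _ _
    change p ⬝ᵥ 0 = c at h0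
    change p ⬝ᵥ Pi.single k 1 = c at h1
    rw [dotProduct_zero] at h0
    rw [dotProduct_single_one] at h1
    exact hk (by rw [h1, ← h0]; rfl)
  exact Measure.addHaar_affineSubspace volume s hs

/-- The overlap lies in a hyperplane, hence is null. This lets volumes of the pieces of a
triangulation be added after checking vertices only. -/
theorem volume_real_union_of_separated {n : ℕ} {A B : Set (Fin n → ℝ)} (hA : IsCompact A)
    (hB : IsCompact B) {p : Fin n → ℝ} (hp : p ≠ 0) (c : ℝ) (hAc : A ⊆ {x | p ⬝ᵥ x ≤ c})
    (hBc : B ⊆ {x | c ≤ p ⬝ᵥ x}) :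
    volume.real (A ∪ B) = volume.real A + volume.real B := by
  have hd : AEDisjoint volume A B :=
    measure_mono_null (fun x hx => le_antisymm (hAc hx.1) (hBc hx.2)) (volume_hyperplane hp c)
  rw [measureReal_def, measure_union₀ hB.measurableSet.nullMeasurableSet hd,
    ENNReal.toReal_add hA.measure_lt_top.ne hB.measure_lt_top.ne]
  rfl

theorem tetra_subset_le {a b c d p : Fin 3 → ℝ} {r : ℝ} (ha : p ⬝ᵥ a ≤ r) (hb : p ⬝ᵥ b ≤ r)
    (hc : p ⬝ᵥ c ≤ r) (hd : p ⬝ᵥ d ≤ r) : tetra a b c d ⊆ {x | p ⬝ᵥ x ≤ r} :=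
  tetra_subset (convex_halfSpace_le (dotProductBilin ℝ ℝ p).isLinear r) ha hb hc hd

theorem tetra_subset_ge {a b c d p : Fin 3 → ℝ} {r : ℝ} (ha : r ≤ p ⬝ᵥ a) (hb : r ≤ p ⬝ᵥ b)
    (hc : r ≤ p ⬝ᵥ c) (hd : r ≤ p ⬝ᵥ d) : tetra a b c d ⊆ {x | r ≤ p ⬝ᵥ x} :=
  tetra_subset (convex_halfSpace_ge (dotProductBilin ℝ ℝ p).isLinear r) ha hb hc hd

/-! ### The polytope of volume 7/6 and the competitors of volume at least 4/3. -/

/-- The Newton polytope of `f₁ ⊕ (x_3 ⊙ g₁)`, cut out by inequalities. -/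
def minPolytope : Set (Fin 3 → ℝ) :=
  {x | 0 ≤ x 0 ∧ 0 ≤ x 1 ∧ 0 ≤ x 2 ∧ x 2 ≤ 1 ∧ 1 ≤ x 0 + x 1 ∧ x 0 + x 1 ≤ 2 ∧
    x 0 + x 2 ≤ 2 ∧ x 1 + x 2 ≤ 2}

theorem convex_minPolytope : Convex ℝ minPolytope := by
  intro x hx y hy a b ha hb hab
  obtain ⟨x1, x2, x3, x4, x5, x6, x7, x8⟩ := hx
  obtain ⟨y1, y2, y3, y4, y5, y6, y7, y8⟩ := hy
  have hb' : b = 1 - a := by linarith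
  subst hb'
  simp only [minPolytope, Set.mem_ofPred_eq, Pi.add_apply, Pi.smul_apply, smul_eq_mul]
  refine ⟨?_, ?_, ?_, ?_, ?_, ?_, ?_, ?_⟩ <;> nlinarith

/-- The cuts are `x₀ + x₁ + x₂ = 2`, then `x₀ + 2x₁ = 2` on the lower side, and `x₁ = x₂` on what
remains below and on the upper side. The weights given to `mem_tetra` are the barycentric
coordinates in each piece. -/
theorem minPolytope_eq : minPolytope =
    (tetra ![0, 1, 0] ![2, 0, 0] ![0, 2, 0] ![0, 1, 1] ∪
      (tetra ![0, 1, 0] ![1, 0, 0] ![2, 0, 0] ![0, 1, 1] ∪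
        tetra ![1, 0, 0] ![2, 0, 0] ![0, 1, 1] ![1, 0, 1])) ∪
    (tetra ![2, 0, 0] ![0, 2, 0] ![0, 1, 1] ![1, 1, 1] ∪
      tetra ![2, 0, 0] ![0, 1, 1] ![1, 0, 1] ![1, 1, 1]) := by
  apply Set.Subset.antisymm
  · rintro x ⟨h1, h2, h3, h4, h5, h6, h7, h8⟩
    rcases le_total (x 0 + x 1 + x 2) 2 with hl | hl
    · refine Or.inl ?_
      rcases le_total 2 (x 0 + 2 * x 1) with hm | hm
      · refine Or.inl (mem_tetra (2 - x 0 - x 1 - x 2) (x 0 / 2) (x 1 - 1 + x 0 / 2) (x 2)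
          (by linarith) (by linarith) (by linarith) (by linarith) (by ring) ?_)
        simp [Fin.forall_fin_succ]
        ring
      · refine Or.inr ?_
        rcases le_total (x 2) (x 1) with hn | hn
        · refine Or.inl (mem_tetra (x 1 - x 2) (2 - 2 * x 1 - x 0) (x 0 + x 1 - 1) (x 2)
            (by linarith) (by linarith) (by linarith) (by linarith) (by ring) ?_)
          simp [Fin.forall_fin_succ]
          ring
        · refine Or.inr (mem_tetra (2 - x 2 - x 0 - x 1) (x 0 + x 1 - 1) (x 1) (x 2 - x 1)
            (by linarith) (by linarith) (by linarith) (by linarith) (by ring) ?_)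
          simp [Fin.forall_fin_succ]
          ring
    · refine Or.inr ?_
      rcases le_total (x 2) (x 1) with hn | hn
      · refine Or.inl (mem_tetra ((2 - x 1 - x 2) / 2) ((x 1 - x 2) / 2) (2 - x 0 - x 1)
          (x 0 + x 1 + x 2 - 2)
          (by linarith) (by linarith) (by linarith) (by linarith) (by ring) ?_)
        simp [Fin.forall_fin_succ]
        constructorm* _ ∧ _ <;> ring
      · refine Or.inr (mem_tetra (1 - x 2) (2 - x 0 - x 2) (x 2 - x 1) (x 0 + x 1 + x 2 - 2)
          (by linarith) (by linarith) (by linarith) (by linarith) (by ring) ?_)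
        simp [Fin.forall_fin_succ]
        constructorm* _ ∧ _ <;> ring
  · have h := convex_minPolytope
    refine Set.union_subset (Set.union_subset ?_ (Set.union_subset ?_ ?_))
      (Set.union_subset ?_ ?_) <;> refine tetra_subset h ?_ ?_ ?_ ?_ <;> simp [minPolytope] <;>
      norm_num

/-- The five tetrahedra contribute 2, 1, 1, 2 and 1 sixths. -/
theorem volume_minPolytope : volume.real minPolytope = 7 / 6 := by
  have c := isCompact_tetra
  rw [minPolytope_eq]
  rw [volume_real_union_of_separated (p := ![1, 1, 1]) ((c _ _ _ _).union ((c _ _ _ _).union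
      (c _ _ _ _))) ((c _ _ _ _).union (c _ _ _ _)) (by simp) 2
      (Set.union_subset (tetra_subset_le ?_ ?_ ?_ ?_)
        (Set.union_subset (tetra_subset_le ?_ ?_ ?_ ?_) (tetra_subset_le ?_ ?_ ?_ ?_)))
      (Set.union_subset (tetra_subset_ge ?_ ?_ ?_ ?_) (tetra_subset_ge ?_ ?_ ?_ ?_)),
    volume_real_union_of_separated (p := ![-1, -2, 0]) (c _ _ _ _) ((c _ _ _ _).union (c _ _ _ _))
      (by simp) (-2) (tetra_subset_le ?_ ?_ ?_ ?_)
      (Set.union_subset (tetra_subset_ge ?_ ?_ ?_ ?_) (tetra_subset_ge ?_ ?_ ?_ ?_)),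
    volume_real_union_of_separated (p := ![0, -1, 1]) (c _ _ _ _) (c _ _ _ _) (by simp) 0
      (tetra_subset_le ?_ ?_ ?_ ?_) (tetra_subset_ge ?_ ?_ ?_ ?_),
    volume_real_union_of_separated (p := ![0, -1, 1]) (c _ _ _ _) (c _ _ _ _) (by simp) 0
      (tetra_subset_le ?_ ?_ ?_ ?_) (tetra_subset_ge ?_ ?_ ?_ ?_)]
  · simp only [volume_real_tetra_eq]
    norm_num
  all_goals
    rw [dotProduct_fin_three]
    norm_num

/-- A convex body containing the pyramid over a triangle at height `0` with base parallel to
`(1, -1)`, together with a tetrahedron at its long edge. -/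
theorem le_volume_of_width {K : Set (Fin 3 → ℝ)} (hK : Convex ℝ K) (hKc : IsCompact K)
    {a b c d e f w m : ℝ} (hw : 2 ≤ w) (hm : 2 ≤ m)
    (hab : e + f + w = a + b) (hcd : c + d = a + b)
    (h₁ : ![a + m, b - m, 0] ∈ K) (h₂ : ![a, b, 0] ∈ K) (h₃ : ![e, f, 0] ∈ K)
    (h₄ : ![e, f, 1] ∈ K) (h₅ : ![c, d, 1] ∈ K) : 4 / 3 ≤ volume.real K := by
  have key := volume_real_union_of_separated (p := ![1, 1, w])
    (isCompact_tetra ![a + m, b - m, 0] ![a, b, 0] ![e, f, 0] ![e, f, 1])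
    (isCompact_tetra ![a + m, b - m, 0] ![a, b, 0] ![e, f, 1] ![c, d, 1]) (by simp) (a + b)
    (tetra_subset_le ?_ ?_ ?_ ?_) (tetra_subset_ge ?_ ?_ ?_ ?_)
  · have hsub := measureReal_mono (μ := volume) (Set.union_subset
      (tetra_subset hK h₁ h₂ h₃ h₄) (tetra_subset hK h₁ h₂ h₄ h₅)) hKc.measure_lt_top.ne
    rw [key] at hsub
    refine le_trans ?_ hsub
    rw [volume_real_tetra_eq, volume_real_tetra_eq]
    obtain rfl : f = a + b - w - e := by linarith
    obtain rfl : d = a + b - c := by linarith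
    -- Each of the two tetrahedra has volume `m * w / 6`.
    have h : 4 ≤ m * w := by nlinarith
    ring_nf
    rw [abs_of_nonneg (by linarith)]
    linarith
  all_goals
    rw [dotProduct_fin_three]
    linarith

/-- A convex body containing the pyramid over a trapezoid at height `0` with sides parallel to
`(1, -1)`, together with a tetrahedron at its long edge. -/
theorem le_volume_of_trapezoid {K : Set (Fin 3 → ℝ)} (hK : Convex ℝ K) (hKc : IsCompact K)
    {a b r : ℝ} (hr : 1 ≤ r) (h₁ : ![a, b, 0] ∈ K) (h₂ : ![a + r + 1, b - r - 1, 0] ∈ K)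
    (h₃ : ![a + r + 2, b - r - 1, 0] ∈ K) (h₄ : ![a, b + 1, 0] ∈ K)
    (h₅ : ![a, b, 1] ∈ K) (h₆ : ![a + 1, b, 1] ∈ K) : 4 / 3 ≤ volume.real K := by
  have c := isCompact_tetra
  have key := volume_real_union_of_separated (p := ![1, 1, 1])
    ((c ![a, b, 0] ![a + r + 2, b - r - 1, 0] ![a, b + 1, 0] ![a, b, 1]).union
      (c ![a, b, 0] ![a + r + 1, b - r - 1, 0] ![a + r + 2, b - r - 1, 0] ![a, b, 1]))
    (c ![a + r + 2, b - r - 1, 0] ![a, b + 1, 0] ![a, b, 1] ![a + 1, b, 1]) (by simp) (a + b + 1)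
    (Set.union_subset (tetra_subset_le ?_ ?_ ?_ ?_) (tetra_subset_le ?_ ?_ ?_ ?_))
    (tetra_subset_ge ?_ ?_ ?_ ?_)
  have key' := volume_real_union_of_separated (p := ![-(r + 1), -(r + 2), 0])
    (c ![a, b, 0] ![a + r + 2, b - r - 1, 0] ![a, b + 1, 0] ![a, b, 1])
    (c ![a, b, 0] ![a + r + 1, b - r - 1, 0] ![a + r + 2, b - r - 1, 0] ![a, b, 1]) (by
      intro h
      have := congrFun h 0
      simp at this
      linarith) (-(r + 1) * a - (r + 2) * b)
    (tetra_subset_le ?_ ?_ ?_ ?_) (tetra_subset_ge ?_ ?_ ?_ ?_)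
  · have hsub := measureReal_mono (μ := volume) (Set.union_subset (Set.union_subset
      (tetra_subset hK h₁ h₃ h₄ h₅) (tetra_subset hK h₁ h₂ h₃ h₅)) (tetra_subset hK h₃ h₄ h₅ h₆))
      hKc.measure_lt_top.ne
    rw [key, key'] at hsub
    refine le_trans ?_ hsub
    rw [volume_real_tetra_eq, volume_real_tetra_eq, volume_real_tetra_eq]
    -- The three determinants are `r + 2`, `r + 1` and `r + 2`, so the total is `(3r + 5) / 6`,
    -- which is 4/3 at `r = 1`.
    ring_nf
    have e1 : |2 + r| = 2 + r := abs_of_nonneg (by linarith)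
    have e2 : |1 + r| = 1 + r := abs_of_nonneg (by linarith)
    simp only [e1, e2]
    linarith
  all_goals
    rw [dotProduct_fin_three]
    nlinarith

/-! ### Linear regions of a maximum of affine functions. -/

theorem IsMaxOf.continuous {ι X : Type*} [TopologicalSpace X] {E : Finset ι} {l : ι → X → ℝ}
    {H : X → ℝ} (hH : IsMaxOf E l H) (hl : ∀ i ∈ E, Continuous (l i)) : Continuous H := by
  rcases E.eq_empty_or_nonempty with rfl | hE
  · refine continuous_iff_continuousAt.2 fun t => ?_
    obtain ⟨i, hi, -⟩ := (hH t).2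
    simp at hi
  · have : H = fun t => E.sup' hE fun i => l i t := by
      ext t
      obtain ⟨i, hi, h⟩ := (hH t).2
      exact le_antisymm (h ▸ Finset.le_sup' (fun i => l i t) hi)
        (Finset.sup'_le hE _ fun j hj => (hH t).1 j hj)
    rw [this]
    exact Continuous.finset_sup'_apply hE hl

section Regions

variable {n : ℕ} {ι : Type*} {E : Finset ι} {l : ι → (Fin n → ℝ) →ᵃ[ℝ] ℝ}
  {H : (Fin n → ℝ) → ℝ} {F : (Fin n → ℝ) → Trop}

/-- The set on which the maximum `H` is locally given by the affine function `a`. -/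
def region (H : (Fin n → ℝ) → ℝ) (a : (Fin n → ℝ) →ᵃ[ℝ] ℝ) : Set (Fin n → ℝ) :=
  interior {t | H t = a t}

theorem eq_of_mem_region {a : (Fin n → ℝ) →ᵃ[ℝ] ℝ} {t : Fin n → ℝ} (ht : t ∈ region H a) :
    H t = a t :=
  (interior_subset ht : t ∈ {t | H t = a t})

theorem affineMap_continuous (a : (Fin n → ℝ) →ᵃ[ℝ] ℝ) : Continuous a :=
  a.continuous_of_finiteDimensional

theorem affineMap_eq_of_eqOn_open {a b : (Fin n → ℝ) →ᵃ[ℝ] ℝ} {U : Set (Fin n → ℝ)}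
    (hU : IsOpen U) (hne : U.Nonempty) (h : ∀ t ∈ U, a t = b t) : a = b :=
  AffineMap.ext_on (hU.affineSpan_eq_top hne) h

theorem region_isAffineOn (hF : ∀ t, F t = ofReal (H t)) (a : (Fin n → ℝ) →ᵃ[ℝ] ℝ) :
    IsAffineOn F (region H a) :=
  Or.inl ⟨a, fun t ht => by rw [hF, eq_of_mem_region ht]⟩

theorem IsAffineOn.exists_affineMap (hF : ∀ t, F t = ofReal (H t)) {U : Set (Fin n → ℝ)}
    (hne : U.Nonempty) (h : IsAffineOn F U) :
    ∃ a : (Fin n → ℝ) →ᵃ[ℝ] ℝ, ∀ t ∈ U, H t = a t := by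
  rcases h with ⟨a, ha⟩ | h0
  · exact ⟨a, fun t ht => ofReal_injective (by rw [← hF, ha t ht])⟩
  · obtain ⟨t, ht⟩ := hne
    exact absurd (h0 t ht) (hF t ▸ ofReal_ne_zero _)

/-- As `H ≥ l i` everywhere, the set `H = l i` is the sublevel set `H ≤ l i`, convex because `H - l
i` is a maximum of affine functions. -/
theorem convex_region (hH : IsMaxOf E (fun i => l i) H) {i : ι} (hi : i ∈ E) :
    Convex ℝ (region H (l i)) := by
  refine Convex.interior ?_
  intro t ht u hu a b ha hb hab
  refine le_antisymm ?_ ((hH _).1 i hi)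
  obtain ⟨j, hj, h⟩ := (hH (a • t + b • u)).2
  rw [h]
  simp only
  rw [Convex.combo_affine_apply hab, Convex.combo_affine_apply hab]
  have h1 : l j t ≤ l i t := ((hH t).1 j hj).trans_eq ht
  have h2 : l j u ≤ l i u := ((hH u).1 j hj).trans_eq hu
  simp only [smul_eq_mul]
  gcongr

theorem isLinearRegion_region (hF : ∀ t, F t = ofReal (H t)) (hH : IsMaxOf E (fun i => l i) H)
    {i : ι} (hi : i ∈ E) (hne : (region H (l i)).Nonempty) :
    IsLinearRegion F (region H (l i)) := by
  refine ⟨⟨isOpen_interior, ⟨hne, (convex_region hH hi).isPreconnected⟩, region_isAffineOn hF _⟩, ?_⟩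
  rintro W ⟨hWo, hWc, hWa⟩ hsub
  obtain ⟨a, ha⟩ := hWa.exists_affineMap hF hWc.nonempty
  have : a = l i := affineMap_eq_of_eqOn_open isOpen_interior hne fun t ht => by
    rw [← ha t (hsub ht), eq_of_mem_region (a := l i) ht]
  exact interior_maximal (fun t ht => this ▸ ha t ht) hWo

/-- The finitely many closed sets `H = l i` cover the space, so their interiors are dense and `U`
meets one of them. On that open overlap the affine function of `U` must be `l i`, and maximality
gives equality. -/
theorem IsLinearRegion.eq_region (hF : ∀ t, F t = ofReal (H t))
    (hH : IsMaxOf E (fun i => l i) H) {U : Set (Fin n → ℝ)} (hU : IsLinearRegion F U) :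
    ∃ i ∈ E, U = region H (l i) := by
  have hcont : Continuous H := hH.continuous fun i _ => affineMap_continuous (l i)
  have hdense : Dense (⋃ i : E, interior {t | H t = l i t}) := by
    refine dense_iUnion_interior_of_closed
      (fun i => isClosed_eq hcont (affineMap_continuous (l i))) ?_
    refine Set.eq_univ_of_forall fun t => ?_
    obtain ⟨i, hi, h⟩ := (hH t).2
    exact Set.mem_iUnion.2 ⟨⟨i, hi⟩, h⟩
  obtain ⟨⟨hUo, hUc, hUa⟩, hmax⟩ := hU
  obtain ⟨t, htU, ht⟩ := hdense.inter_open_nonempty U hUo hUc.nonempty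
  obtain ⟨⟨i, hi⟩, hti⟩ := Set.mem_iUnion.1 ht
  obtain ⟨a, ha⟩ := hUa.exists_affineMap hF hUc.nonempty
  have hal : a = l i := affineMap_eq_of_eqOn_open (hUo.inter isOpen_interior) ⟨t, htU, hti⟩
    fun u hu => by rw [← ha u hu.1, eq_of_mem_region (a := l i) hu.2]
  have hsub : U ⊆ region H (l i) := interior_maximal (fun u hu => hal ▸ ha u hu) hUo
  refine ⟨i, hi, hsub.antisymm (hmax ?_ hsub)⟩
  exact (isLinearRegion_region hF hH hi ⟨t, hti⟩).prop

theorem linearRegions_subset (hF : ∀ t, F t = ofReal (H t)) (hH : IsMaxOf E (fun i => l i) H) :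
    {U | IsLinearRegion F U} ⊆ (fun i => region H (l i)) '' (E : Set ι) := fun U hU => by
  obtain ⟨i, hi, h⟩ := IsLinearRegion.eq_region hF hH hU
  exact ⟨i, hi, h.symm⟩

theorem ncard_linearRegions_le (hF : ∀ t, F t = ofReal (H t)) (hH : IsMaxOf E (fun i => l i) H) :
    {U | IsLinearRegion F U}.ncard ≤ E.card := by
  refine (Set.ncard_le_ncard (linearRegions_subset hF hH) (E.finite_toSet.image _)).trans ?_
  exact (Set.ncard_image_le E.finite_toSet).trans_eq (Set.ncard_coe_finset E)

/-- A maximum of finitely many affine functions is the maximum of as many of them as it has linear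
regions. -/
theorem exists_isMaxOf_card_le (hF : ∀ t, F t = ofReal (H t)) (hH : IsMaxOf E (fun i => l i) H) :
    ∃ E' : Finset ι, IsMaxOf E' (fun i => l i) H ∧
      E'.card ≤ {U | IsLinearRegion F U}.ncard := by
  classical
  -- An inclusion-minimal family has no redundant member, so each member is strictly the largest
  -- somewhere. By continuity it is so on an open set, which makes the regions nonempty and
  -- distinct.
  obtain ⟨E', hE', hmin⟩ := exists_minimal_of_wellFoundedLT
    (fun E' : Finset ι => IsMaxOf E' (fun i => l i) H) ⟨E, hH⟩
  refine ⟨E', hE', ?_⟩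
  have hpt : ∀ i ∈ E', ∃ t, H t = l i t ∧ ∀ j ∈ E', j ≠ i → l j t < H t := by
    intro i hi
    by_contra! hcon
    have herase : IsMaxOf (E'.erase i) (fun i => l i) H := by
      intro t
      refine ⟨fun j hj => (hE' t).1 j (Finset.mem_of_mem_erase hj), ?_⟩
      obtain ⟨j, hj, h⟩ := (hE' t).2
      by_cases hji : j = i
      · subst hji
        obtain ⟨k, hk, hne, hle⟩ := hcon t h
        exact ⟨k, Finset.mem_erase.2 ⟨hne, hk⟩, le_antisymm hle ((hE' t).1 k hk)⟩
      · exact ⟨j, Finset.mem_erase.2 ⟨hji, hj⟩, h⟩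
    exact (Finset.notMem_erase i E') (hmin herase (Finset.erase_subset i E') hi)
  have hcont : Continuous H := hE'.continuous fun i _ => affineMap_continuous (l i)
  have hreg : ∀ i ∈ E', ∃ t ∈ region H (l i), ∀ j ∈ E', j ≠ i → l j t < H t := by
    intro i hi
    obtain ⟨t, ht, hlt⟩ := hpt i hi
    refine ⟨t, ?_, hlt⟩
    rw [region, mem_interior_iff_mem_nhds]
    have hev : ∀ᶠ u in 𝓝 t, ∀ j ∈ E', j ≠ i → l j u < H u := by
      refine (Filter.eventually_all_finset E').2 fun j hj => ?_
      by_cases hji : j = i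
      · exact Eventually.of_forall fun u h => absurd hji h
      · filter_upwards [(affineMap_continuous (l j)).continuousAt.eventually_lt
          hcont.continuousAt (hlt j hj hji)] with u hu _ using hu
    filter_upwards [hev] with u hu
    obtain ⟨j, hj, h⟩ := (hE' u).2
    by_cases hji : j = i
    · exact hji ▸ h
    · exact absurd h (hu j hj hji).ne'
  have hinj : Set.InjOn (fun i => region H (l i)) (E' : Set ι) := by
    intro i hi j hj hij
    by_contra hne
    obtain ⟨t, ht, hlt⟩ := hreg i hi
    have : t ∈ region H (l j) := by
      have h := hij
      simp only at h
      exact h ▸ ht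
    exact (hlt j hj (Ne.symm hne)).ne' (eq_of_mem_region this)
  rw [← Set.ncard_coe_finset, ← hinj.ncard_image]
  -- Finiteness matters: `ncard` of an infinite set would be 0.
  refine Set.ncard_le_ncard ?_ ((E.finite_toSet.image _).subset (linearRegions_subset hF hH))
  rintro _ ⟨i, hi, rfl⟩
  obtain ⟨t, ht, -⟩ := hreg i hi
  exact isLinearRegion_region hF hE' hi ⟨t, ht⟩

end Regions

/-! ### Break points along a line and factorization complexity. -/

/-- `h` agrees with its tangent at `x` symmetrically around `x`; for a piecewise linear convex
function this fails exactly at the break points. -/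
def IsBalancedAt (h : ℝ → ℝ) (x : ℝ) : Prop := ∀ᶠ ε in 𝓝[>] (0 : ℝ), h (x + ε) + h (x - ε) = 2 * h x

/-- Used in contrapositive form: a break point of a sum is a break point of a summand. -/
theorem IsBalancedAt.add {h₁ h₂ : ℝ → ℝ} {x : ℝ} (H₁ : IsBalancedAt h₁ x) (H₂ : IsBalancedAt h₂ x) :
    IsBalancedAt (fun s => h₁ s + h₂ s) x := by
  filter_upwards [H₁, H₂] with ε e₁ e₂
  linarith

theorem isBalancedAt_affine (a b x : ℝ) : IsBalancedAt (fun s => a + s * b) x :=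
  Eventually.of_forall fun ε => by ring

theorem IsBalancedAt.congr {h₁ h₂ : ℝ → ℝ} {x : ℝ} (H : IsBalancedAt h₁ x)
    (hev : ∀ᶠ u in 𝓝 x, h₂ u = h₁ u) : IsBalancedAt h₂ x := by
  have hpos : Tendsto (fun ε : ℝ => x + ε) (𝓝[>] 0) (𝓝 x) := by
    have : Tendsto (fun ε : ℝ => x + ε) (𝓝 0) (𝓝 (x + 0)) := by
      exact (continuous_const.add continuous_id).tendsto 0
    rw [add_zero] at this
    exact this.mono_left nhdsWithin_le_nhds
  have hneg : Tendsto (fun ε : ℝ => x - ε) (𝓝[>] 0) (𝓝 x) := by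
    have : Tendsto (fun ε : ℝ => x - ε) (𝓝 0) (𝓝 (x - 0)) := by
      exact (continuous_const.sub continuous_id).tendsto 0
    rw [sub_zero] at this
    exact this.mono_left nhdsWithin_le_nhds
  filter_upwards [H, hpos.eventually hev, hneg.eventually hev] with ε e e₁ e₂
  rw [e₁, e₂, e, hev.self_of_nhds]

/-- If all pieces active at `x` had one slope they would coincide, and the inactive pieces stay
below near `x`, so `h` would be affine there. -/
theorem IsMaxOf.exists_slopes {ι : Type*} {E : Finset ι} {α β : ι → ℝ} {h : ℝ → ℝ}
    (hh : IsMaxOf E (fun i s => α i + s * β i) h) {x : ℝ} (hx : ¬ IsBalancedAt h x) :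
    ∃ i ∈ E, ∃ j ∈ E, h x = α i + x * β i ∧ h x = α j + x * β j ∧ β i < β j := by
  classical
  by_contra! hcon
  apply hx
  obtain ⟨j, hj, hjx⟩ := (hh x).2
  have hslope : ∀ i ∈ E, h x = α i + x * β i → β i = β j := fun i hi hix =>
    le_antisymm (hcon j hj i hi hjx hix) (hcon i hi j hj hix hjx)
  refine (isBalancedAt_affine (α j) (β j) x).congr ?_
  have hcont : Continuous h := hh.continuous fun i _ => by fun_prop
  have hev : ∀ᶠ u in 𝓝 x, ∀ i ∈ E, h x ≠ α i + x * β i → α i + u * β i < h u := by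
    refine (Filter.eventually_all_finset E).2 fun i hi => ?_
    by_cases hix : h x = α i + x * β i
    · exact Eventually.of_forall fun u hne => absurd hix hne
    · have hc : Continuous fun u : ℝ => α i + u * β i := by fun_prop
      filter_upwards [hc.continuousAt.eventually_lt hcont.continuousAt
        (lt_of_le_of_ne ((hh x).1 i hi) (Ne.symm hix))] with u hu _ using hu
  filter_upwards [hev] with u hu
  obtain ⟨i, hi, hiu⟩ := (hh u).2
  by_cases hix : h x = α i + x * β i
  · have := hslope i hi hix
    have h' : α i = α j := by rw [this] at hix; linarith
    rw [hiu]
    simp only [this, h']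
  · exact absurd hiu (hu i hi hix).ne'

/-- A maximum of `m` affine functions of one variable has at most `m - 1` break points. -/
theorem IsMaxOf.card_lt_of_not_isBalancedAt {ι : Type*} {E : Finset ι} {α β : ι → ℝ} {h : ℝ → ℝ}
    (hh : IsMaxOf E (fun i s => α i + s * β i) h) (B : Finset ℝ)
    (hB : ∀ x ∈ B, ¬ IsBalancedAt h x) : B.card < E.card := by
  classical
  rcases B.eq_empty_or_nonempty with rfl | hne
  · obtain ⟨i, hi, -⟩ := (hh 0).2
    exact Finset.card_pos.2 ⟨i, hi⟩
  have : Nonempty ι := ⟨(hh 0).2.choose⟩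
  choose! i hi j hj hix hjx hlt using fun x hx => hh.exists_slopes (hB x hx)
  -- Convexity: the right slope at a break point is at most the left slope at any later one.
  have hmono : ∀ x ∈ B, ∀ y ∈ B, x < y → β (j x) ≤ β (i y) := by
    intro x hx y hy hxy
    have h₁ := (hh x).1 (i y) (hi y hy)
    have h₂ := (hh y).1 (j x) (hj x hx)
    rw [hjx x hx] at h₁
    rw [hix y hy] at h₂
    simp only at h₁ h₂
    by_contra! hcon
    nlinarith
  have hstrict : ∀ x ∈ B, ∀ y ∈ B, x < y → β (j x) < β (j y) := fun x hx y hy hxy =>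
    (hmono x hx y hy hxy).trans_lt (hlt y hy)
  set x₀ := B.min' hne
  have hx₀ : x₀ ∈ B := B.min'_mem hne
  have hle : ∀ x ∈ B, β (i x₀) < β (j x) := by
    intro x hx
    rcases (B.min'_le x hx).eq_or_lt with h | h
    · exact h ▸ hlt x₀ hx₀
    · exact (hlt x₀ hx₀).trans (hstrict x₀ hx₀ x hx h)
  -- The larger-slope pieces at the break points are distinct, and all differ from the smaller-slope
  -- piece at the first one; this piece is the extra `+ 1`.
  have hcard : B.card ≤ (E.erase (i x₀)).card := by
    refine Finset.card_le_card_of_injOn j (fun x hx => ?_) ?_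
    · refine Finset.mem_erase.2 ⟨fun h => ?_, hj x hx⟩
      have := hle x hx
      rw [h] at this
      exact lt_irrefl _ this
    · intro x hx y hy hxy
      rcases lt_trichotomy x y with h | h | h
      · have := hstrict x hx y hy h
        rw [hxy] at this
        exact absurd this (lt_irrefl _)
      · exact h
      · have := hstrict y hy x hx h
        rw [hxy] at this
        exact absurd this (lt_irrefl _)
  exact hcard.trans_lt (Finset.card_erase_lt_of_mem (hi x₀ hx₀))

variable {n : ℕ}

/-- `monomialMap` as an affine map. -/
def monomialAffineMap (f : TropPoly n) (i : Fin n → ℤ) : (Fin n → ℝ) →ᵃ[ℝ] ℝ where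
  toFun := monomialMap f i
  linear :=
    { toFun := pair i
      map_add' := pair_add_right i
      map_smul' := pair_smul_right i }
  map_vadd' t u := by
    simp only [monomialMap, vadd_eq_add, pair_add_right, LinearMap.coe_mk, AddHom.coe_mk]
    ring

theorem isMaxOf_monomialAffineMap {f : TropPoly n} (hf : f ≠ 0) :
    IsMaxOf f.coeff.support (fun i => monomialAffineMap f i) (realEval f) :=
  isMaxOf_realEval hf

/-- A family with no more members than linear regions still represents `f`, and it restricts to the
line as a family of affine functions of `s`. -/
theorem card_lt_mComp {f : TropPoly n} (hf : f ≠ 0) (p v : Fin n → ℝ) (B : Finset ℝ)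
    (hB : ∀ x ∈ B, ¬ IsBalancedAt (fun s => realEval f (p + s • v)) x) : B.card < mComp f := by
  obtain ⟨E, hE, hcard⟩ := exists_isMaxOf_card_le (eval_eq_ofReal hf) (isMaxOf_monomialAffineMap hf)
  refine lt_of_lt_of_le ?_ hcard
  refine IsMaxOf.card_lt_of_not_isBalancedAt (α := fun i => monomialMap f i p)
    (β := fun i => pair i v) (fun s => ?_) B hB
  have heq : ∀ i, monomialAffineMap f i (p + s • v) = monomialMap f i p + s * pair i v := by
    intro i
    change monomialMap f i (p + s • v) = _
    rw [monomialMap, monomialMap, pair_add_right, pair_smul_right]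
    ring
  have := hE (p + s • v)
  simp only [heq] at this
  exact this

theorem mComp_le_card {ι : Type*} {f : TropPoly n} {E : Finset ι} {l : ι → (Fin n → ℝ) →ᵃ[ℝ] ℝ}
    (hf : f ≠ 0) (hE : IsMaxOf E (fun i => l i) (realEval f)) : mComp f ≤ E.card :=
  ncard_linearRegions_le (eval_eq_ofReal hf) hE

/-- Each factor with `k` break points on the line has at least `k + 1` regions. Summing over the
factors gives the term `L.length`, which `fComp` then offsets by `m - 1`. -/
theorem card_le_sum_mComp (p v : Fin n → ℝ) (L : List (TropPoly n)) (hL : L.prod ≠ 0) :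
    ∀ B : Finset ℝ, (∀ x ∈ B, ¬ IsBalancedAt (fun s => realEval L.prod (p + s • v)) x) →
      (B.card : ℤ) + L.length ≤ (L.map fun f => (mComp f : ℤ)).sum := by
  classical
  induction L with
  | nil =>
    intro B hB
    have : B = ∅ := Finset.eq_empty_of_forall_notMem fun x hx => hB x hx (by
      have h : ∀ t, realEval ([] : List (TropPoly n)).prod t = 0 := fun t =>
        realEval_eq_of_eval_eq (by rw [List.prod_nil, eval_one])
      simp only [h]
      exact Eventually.of_forall fun ε => by ring)
    simp [this]
  | cons f L ih =>
    intro B hB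
    rw [List.prod_cons] at hL hB
    have hf : f ≠ 0 := left_ne_zero_of_mul hL
    have hL' : L.prod ≠ 0 := right_ne_zero_of_mul hL
    have hmul : ∀ t, realEval (f * L.prod) t = realEval f t + realEval L.prod t := fun t =>
      realEval_eq_of_eval_eq (by
        rw [eval_mul, eval_eq_ofReal hf, eval_eq_ofReal hL', ofReal_mul_ofReal])
    simp only [hmul] at hB
    set B₁ := B.filter fun x => ¬ IsBalancedAt (fun s => realEval f (p + s • v)) x with hB₁
    set B₂ := B.filter fun x => ¬ IsBalancedAt (fun s => realEval L.prod (p + s • v)) x with hB₂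
    have hsub : B ⊆ B₁ ∪ B₂ := by
      intro x hx
      simp only [hB₁, hB₂, Finset.mem_union, Finset.mem_filter, hx, true_and]
      by_contra! hcon
      exact hB x hx (hcon.1.add hcon.2)
    have hcard := (Finset.card_le_card hsub).trans (Finset.card_union_le _ _)
    have h₁ := card_lt_mComp hf p v B₁ fun x hx => (Finset.mem_filter.1 hx).2
    have h₂ := ih hL' B₂ fun x hx => (Finset.mem_filter.1 hx).2
    simp only [List.map_cons, List.sum_cons, List.length_cons]
    push_cast
    zify at hcard h₁
    linarith

/-- The factorization complexity of `f` is larger than the number of break points of `f` along any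
line. -/
theorem card_lt_fComp {f : TropPoly n} (hf : f ≠ 0) {L : List (TropPoly n)}
    (hL : IsFactorization f L) (p v : Fin n → ℝ) (B : Finset ℝ)
    (hB : ∀ x ∈ B, ¬ IsBalancedAt (fun s => realEval f (p + s • v)) x) :
    (B.card : ℤ) < fComp L := by
  have hev : ∀ t, eval f t = eval L.prod t := fun t => congrFun hL.2 t
  have hprod : L.prod ≠ 0 := ne_zero_of_eval_ne_zero (hev 0 ▸ eval_ne_zero hf 0)
  have hre : ∀ t, realEval f t = realEval L.prod t := fun t => by rw [realEval, hev, realEval]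
  simp only [hre] at hB
  have := card_le_sum_mComp p v L hprod B hB
  rw [fComp]
  linarith

/-! ### Growth along rays and dominant monomials. -/

section Recession

variable {n : ℕ} {f g : TropPoly n} {u : Fin n → ℝ} {p q : Fin n → ℤ}

theorem exists_abs_realEval_sub_le (hf : f ≠ 0) (hp : p ∈ f.coeff.support)
    (hmax : ∀ i ∈ f.coeff.support, pair i u ≤ pair p u) :
    ∃ C, ∀ s : ℝ, 0 < s → |realEval f (s • u) - s * pair p u| ≤ C := by
  obtain ⟨C, hC⟩ := (f.coeff.support.image fun i => |toReal (f.coeff i)|).exists_le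
  refine ⟨C, fun s hs => ?_⟩
  have hb : ∀ i ∈ f.coeff.support, |toReal (f.coeff i)| ≤ C := fun i hi =>
    hC _ (Finset.mem_image_of_mem _ hi)
  rw [abs_le]
  obtain ⟨hle, i, hi, heq⟩ := isMaxOf_realEval hf (s • u)
  have h₁ := hle p hp
  rw [monomialMap, pair_smul_right] at h₁ heq
  have h₂ := mul_le_mul_of_nonneg_left (hmax i hi) hs.le
  have h₃ := abs_le.1 (hb i hi)
  have h₄ := abs_le.1 (hb p hp)
  constructor <;> linarith

/-- The support functions of the Newton polytopes of `f` and `g` differ by `φ`, if the functions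
`f` and `g` do and `φ` is positively homogeneous. -/
theorem pair_eq_pair_add {φ : (Fin n → ℝ) → ℝ} (hf : f ≠ 0) (hg : g ≠ 0)
    (hφ : ∀ t, realEval f t = realEval g t + φ t) (hhom : ∀ s : ℝ, 0 < s → φ (s • u) = s * φ u)
    (hp : p ∈ f.coeff.support) (hpmax : ∀ i ∈ f.coeff.support, pair i u ≤ pair p u)
    (hq : q ∈ g.coeff.support) (hqmax : ∀ i ∈ g.coeff.support, pair i u ≤ pair q u) :
    pair p u = pair q u + φ u := by
  obtain ⟨C, hC⟩ := exists_abs_realEval_sub_le hf hp hpmax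
  obtain ⟨D, hD⟩ := exists_abs_realEval_sub_le hg hq hqmax
  have hbound : ∀ s : ℝ, 0 < s → s * |pair p u - pair q u - φ u| ≤ C + D := by
    intro s hs
    have h₁ := abs_le.1 (hC s hs)
    have h₂ := abs_le.1 (hD s hs)
    have h₃ := hφ (s • u)
    rw [hhom s hs] at h₃
    rw [← abs_of_pos hs, ← abs_mul, abs_le]
    constructor <;> nlinarith
  by_contra hne
  have hpos : 0 < |pair p u - pair q u - φ u| :=
    abs_pos.2 fun h => hne (by linarith)
  -- This `s` makes the left side `|C + D| + 1`, exceeding the bound.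
  have h := hbound ((|C + D| + 1) / |pair p u - pair q u - φ u|) (by positivity)
  rw [div_mul_cancel₀ _ hpos.ne'] at h
  linarith [le_abs_self (C + D)]

theorem eventually_realEval_eq (hf : f ≠ 0) (hp : p ∈ f.coeff.support)
    (hmax : ∀ i ∈ f.coeff.support, i ≠ p → pair i u < pair p u) :
    ∀ᶠ s : ℝ in atTop, realEval f (s • u) = toReal (f.coeff p) + s * pair p u := by
  have hev : ∀ᶠ s : ℝ in atTop, ∀ i ∈ f.coeff.support, i ≠ p →
      toReal (f.coeff i) + s * pair i u < toReal (f.coeff p) + s * pair p u := by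
    refine (Filter.eventually_all_finset _).2 fun i hi => ?_
    by_cases hip : i = p
    · exact Eventually.of_forall fun s h => absurd hip h
    · have hlt := sub_pos.2 (hmax i hi hip)
      filter_upwards [eventually_gt_atTop
        ((toReal (f.coeff i) - toReal (f.coeff p)) / (pair p u - pair i u))] with s hs _
      rw [div_lt_iff₀ hlt] at hs
      linarith
  filter_upwards [hev] with s hs
  obtain ⟨hle, i, hi, heq⟩ := isMaxOf_realEval hf (s • u)
  rw [monomialMap, pair_smul_right] at heq
  by_cases hip : i = p
  · rw [heq, hip]
  · have h₁ := hle p hp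
    rw [monomialMap, pair_smul_right] at h₁
    exact absurd (hs i hi hip) (not_lt.2 (heq ▸ h₁))

/-- Monomials of `f` and `g` that dominate along the same ray have the same coefficient. -/
theorem coeff_eq_of_dominant {φ : (Fin n → ℝ) → ℝ} (hf : f ≠ 0) (hg : g ≠ 0)
    (hφ : ∀ t, realEval f t = realEval g t + φ t) (hhom : ∀ s : ℝ, 0 < s → φ (s • u) = s * φ u)
    (hp : p ∈ f.coeff.support) (hpmax : ∀ i ∈ f.coeff.support, i ≠ p → pair i u < pair p u)
    (hq : q ∈ g.coeff.support) (hqmax : ∀ i ∈ g.coeff.support, i ≠ q → pair i u < pair q u)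
    (hpq : pair p u = pair q u + φ u) :
    toReal (f.coeff p) = toReal (g.coeff q) := by
  obtain ⟨s, h₁, h₂, hs⟩ := ((eventually_realEval_eq hf hp hpmax).and
    ((eventually_realEval_eq hg hq hqmax).and (eventually_gt_atTop 0))).exists
  have h := hφ (s • u)
  rw [h₁, h₂, hhom s hs, hpq] at h
  linarith

/-- The lexicographic maximum for `(u, v)` wins in direction `u + εv` for all small `ε > 0`: a
strict loss along `u` persists, and ties are decided by `v`. -/
theorem exists_eventually_max {S : Finset (Fin n → ℤ)} (hS : S.Nonempty) (u v : Fin n → ℝ) :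
    ∃ q ∈ S, ∀ᶠ ε : ℝ in 𝓝[>] 0, ∀ i ∈ S, pair i u + ε * pair i v ≤ pair q u + ε * pair q v := by
  obtain ⟨q, hq, hmax⟩ := S.exists_max_image (fun i => toLex (pair i u, pair i v)) hS
  refine ⟨q, hq, (Filter.eventually_all_finset _).2 fun i hi => ?_⟩
  rcases (Prod.Lex.le_iff.1 (hmax i hi)) with h | ⟨h₁, h₂⟩
  · simp only [ofLex_toLex] at h
    have hc₁ : Continuous fun ε : ℝ => pair i u + ε * pair i v := by fun_prop
    have hc₂ : Continuous fun ε : ℝ => pair q u + ε * pair q v := by fun_prop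
    have := hc₁.continuousAt.eventually_lt (x₀ := (0 : ℝ)) hc₂.continuousAt (by simpa using h)
    filter_upwards [nhdsWithin_le_nhds this] with ε hε using hε.le
  · simp only [ofLex_toLex] at h₁ h₂
    filter_upwards [self_mem_nhdsWithin] with ε hε
    rw [h₁]
    have := mul_le_mul_of_nonneg_left h₂ (le_of_lt (Set.mem_Ioi.1 hε))
    linarith

end Recession

/-! ### The polytope of a pair: exponents of `f` at height 0 and of `g` at height 1. -/

section NewtonPolytope

theorem mem_support_add {n : ℕ} (f g : TropPoly n) (j : Fin n → ℤ) :
    j ∈ (f + g).coeff.support ↔ j ∈ f.coeff.support ∨ j ∈ g.coeff.support := by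
  rw [AddMonoidAlgebra.coeff_add, Finsupp.mem_support_iff, Finsupp.add_apply, Ne,
    Tropical.add_eq_zero_iff, not_and_or, ← Ne, ← Ne, ← Finsupp.mem_support_iff,
    ← Finsupp.mem_support_iff]

variable {n : ℕ} (f g : TropPoly n)

theorem mem_support_lift {j : Fin (n + 1) → ℤ} :
    j ∈ (lift f).coeff.support ↔ ∃ i ∈ f.coeff.support, Fin.snoc i 0 = j := by
  classical
  have hinj : Function.Injective fun i : Fin n → ℤ => (Fin.snoc i 0 : Fin (n + 1) → ℤ) :=
    fun i i' h => (Fin.snoc_injective2 h).1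
  rw [lift, AddMonoidAlgebra.mapDomain, Finsupp.mapDomain_support_of_injective hinj]
  simp

theorem mem_support_lift_add {j : Fin (n + 1) → ℤ} :
    j ∈ (lift f + var (Fin.last n) * lift g).coeff.support ↔
      (∃ i ∈ f.coeff.support, Fin.snoc i 0 = j) ∨ ∃ i ∈ g.coeff.support, Fin.snoc i 1 = j := by
  classical
  have h : ∀ i : Fin n → ℤ, Pi.single (Fin.last n) 1 + (Fin.snoc i 0 : Fin (n + 1) → ℤ) =
      (Fin.snoc i 1 : Fin (n + 1) → ℤ) := by
    intro i
    ext k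
    refine Fin.lastCases ?_ (fun k => ?_) k <;> simp
  rw [← mem_support_lift, mem_support_add, var, AddMonoidAlgebra.support_coeff_single_mul _ _ (by simp)]
  simp only [Finset.mem_map, mem_support_lift]
  simp [h]

theorem newt_subset_iff {K : Set (Fin 3 → ℝ)} (hK : Convex ℝ K) (f g : TropPoly 2) :
    newt (lift f + var (Fin.last 2) * lift g) ⊆ K ↔
      (∀ i ∈ f.coeff.support, ![(i 0 : ℝ), (i 1 : ℝ), 0] ∈ K) ∧
        ∀ i ∈ g.coeff.support, ![(i 0 : ℝ), (i 1 : ℝ), 1] ∈ K := by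
  have h : ∀ (i : Fin 2 → ℤ) (a : ℤ), (fun k => (((Fin.snoc i a : Fin 3 → ℤ) k : ℤ) : ℝ)) =
      ![(i 0 : ℝ), (i 1 : ℝ), (a : ℝ)] := by
    intro i a
    ext k
    fin_cases k <;> rfl
  rw [newt, hK.convexHull_subset_iff, Set.image_subset_iff]
  constructor
  · intro hsub
    constructor
    · intro i hi
      have := hsub ((mem_support_lift_add f g).2 (Or.inl ⟨i, hi, rfl⟩))
      simpa [h] using this
    · intro i hi
      have := hsub ((mem_support_lift_add f g).2 (Or.inr ⟨i, hi, rfl⟩))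
      simpa [h] using this
  · rintro ⟨hf, hg⟩ j hj
    rcases (mem_support_lift_add f g).1 hj with ⟨i, hi, rfl⟩ | ⟨i, hi, rfl⟩
    · simpa [h] using hf i hi
    · simpa [h] using hg i hi

theorem convex_newt : Convex ℝ (newt f) := convex_convexHull ℝ _

theorem isCompact_newt : IsCompact (newt f) :=
  (f.coeff.support.finite_toSet.image _).isCompact_convexHull ℝ

end NewtonPolytope

/-! ### The function `φ`, its five cones of linearity, and corners of Newton polygons. -/

/-- The function `max (2x, x + y, 2y, x, y)`. -/
def numer (t : Fin 2 → ℝ) : ℝ :=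
  max (max (max (max (2 * t 0) (t 0 + t 1)) (2 * t 1)) (t 0)) (t 1)

/-- The function `max (x + y, x, y)`. -/
def denom (t : Fin 2 → ℝ) : ℝ := max (max (t 0 + t 1) (t 0)) (t 1)

/-- The function `numer - denom`. -/
def ratio (t : Fin 2 → ℝ) : ℝ := numer t - denom t

theorem ratio_smul {s : ℝ} (hs : 0 < s) (t : Fin 2 → ℝ) : ratio (s • t) = s * ratio t := by
  simp only [ratio, numer, denom, Pi.smul_apply, smul_eq_mul, mul_sub, mul_max_of_nonneg _ _ hs.le,
    mul_add]
  ring_nf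

theorem ratio_of_nonneg_of_le {t : Fin 2 → ℝ} (h₁ : 0 ≤ t 1) (h₂ : t 1 ≤ t 0) :
    ratio t = t 0 - t 1 := by
  simp only [ratio, numer, denom, max_def]
  split_ifs <;> linarith

theorem ratio_of_nonneg_of_ge {t : Fin 2 → ℝ} (h₁ : 0 ≤ t 0) (h₂ : t 0 ≤ t 1) :
    ratio t = t 1 - t 0 := by
  simp only [ratio, numer, denom, max_def]
  split_ifs <;> linarith

theorem ratio_of_nonpos_right {t : Fin 2 → ℝ} (h₁ : 0 ≤ t 0) (h₂ : t 1 ≤ 0) : ratio t = t 0 := by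
  simp only [ratio, numer, denom, max_def]
  split_ifs <;> linarith

theorem ratio_of_nonpos_left {t : Fin 2 → ℝ} (h₁ : t 0 ≤ 0) (h₂ : 0 ≤ t 1) : ratio t = t 1 := by
  simp only [ratio, numer, denom, max_def]
  split_ifs <;> linarith

theorem ratio_of_nonpos {t : Fin 2 → ℝ} (h₁ : t 0 ≤ 0) (h₂ : t 1 ≤ 0) : ratio t = 0 := by
  simp only [ratio, numer, denom, max_def]
  split_ifs <;> linarith

/-- `q` is the largest element of `S` in the direction `(a, b)`, ties being broken by the
direction `(c, d)`. -/
def IsCorner (S : Finset (Fin 2 → ℤ)) (a b c d : ℤ) (q : Fin 2 → ℤ) : Prop :=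
  q ∈ S ∧ ∀ i ∈ S, a * i 0 + b * i 1 ≤ a * q 0 + b * q 1 ∧
    (a * i 0 + b * i 1 = a * q 0 + b * q 1 → c * i 0 + d * i 1 ≤ c * q 0 + d * q 1)

/-- Letting `ε → 0` gives the inequality in the main direction; if that is an equality, it cancels
and dividing by `ε` gives the tie-break. -/
theorem isCorner_of_eventually {S : Finset (Fin 2 → ℤ)} {a b c d : ℤ} {q : Fin 2 → ℤ} (hq : q ∈ S)
    (h : ∀ᶠ ε : ℝ in 𝓝[>] 0, ∀ i ∈ S, pair i ![(a : ℝ), b] + ε * pair i ![(c : ℝ), d] ≤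
      pair q ![(a : ℝ), b] + ε * pair q ![(c : ℝ), d]) : IsCorner S a b c d q := by
  refine ⟨hq, fun i hi => ⟨?_, fun heq => ?_⟩⟩
  · have hlim : ∀ j : Fin 2 → ℤ, Tendsto (fun ε : ℝ => pair j ![(a : ℝ), b] +
        ε * pair j ![(c : ℝ), d]) (𝓝[>] 0) (𝓝 (pair j ![(a : ℝ), b])) := by
      intro j
      have hc : Continuous fun ε : ℝ => pair j ![(a : ℝ), b] + ε * pair j ![(c : ℝ), d] := by
        fun_prop
      have := hc.tendsto 0
      rw [zero_mul, add_zero] at this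
      exact this.mono_left nhdsWithin_le_nhds
    have := le_of_tendsto_of_tendsto (hlim i) (hlim q) (h.mono fun ε hε => hε i hi)
    simp only [pair_fin_two, Matrix.cons_val_zero, Matrix.cons_val_one] at this
    have h' : (a : ℝ) * i 0 + b * i 1 ≤ a * q 0 + b * q 1 := by linarith
    exact_mod_cast h'
  · obtain ⟨ε, hε, hpos⟩ := (h.and self_mem_nhdsWithin).exists
    have h₁ := hε i hi
    have heq' : (a : ℝ) * i 0 + b * i 1 = a * q 0 + b * q 1 := by exact_mod_cast heq
    simp only [pair_fin_two, Matrix.cons_val_zero, Matrix.cons_val_one] at h₁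
    have h₂ : ε * ((i 0 : ℝ) * c + i 1 * d) ≤ ε * ((q 0 : ℝ) * c + q 1 * d) := by linarith
    have h₃ := le_of_mul_le_mul_left h₂ hpos
    have h' : (c : ℝ) * i 0 + d * i 1 ≤ c * q 0 + d * q 1 := by linarith
    exact_mod_cast h'

/-- Corresponding corners of the Newton polytopes of `f` and `g` differ by the slope of `f - g`. -/
theorem exists_isCorner {f g : TropPoly 2} (hf : f ≠ 0) (hg : g ≠ 0)
    (hφ : ∀ t, realEval f t = realEval g t + ratio t) (a b c d k l : ℤ) (hdet : a * d - b * c ≠ 0)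
    (hlin : ∀ ε : ℝ, 0 < ε → ε < 1 → ratio ![a + ε * c, b + ε * d] =
      k * (a + ε * c) + l * (b + ε * d)) :
    ∃ q, IsCorner g.coeff.support a b c d q ∧ IsCorner f.coeff.support a b c d (q + ![k, l]) := by
  obtain ⟨q, hq, hqmax⟩ := exists_eventually_max (support_nonempty hg) ![(a : ℝ), b] ![(c : ℝ), d]
  obtain ⟨p, hp, hpmax⟩ := exists_eventually_max (support_nonempty hf) ![(a : ℝ), b] ![(c : ℝ), d]
  have hdir : ∀ (i : Fin 2 → ℤ) (ε : ℝ), pair i ![(a : ℝ), b] + ε * pair i ![(c : ℝ), d] =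
      pair i ![a + ε * c, b + ε * d] := by
    intro i ε
    simp only [pair_fin_two, Matrix.cons_val_zero, Matrix.cons_val_one]
    ring
  have hev : ∀ᶠ ε : ℝ in 𝓝[>] 0, ((p 0 - q 0 - k : ℤ) : ℝ) * (a + ε * c) +
      ((p 1 - q 1 - l : ℤ) : ℝ) * (b + ε * d) = 0 := by
    filter_upwards [hqmax, hpmax, Ioo_mem_nhdsGT (zero_lt_one' ℝ)] with ε h₁ h₂ hε
    simp only [hdir] at h₁ h₂
    have := pair_eq_pair_add hf hg hφ (fun s hs => ratio_smul hs _) hp h₂ hq h₁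
    rw [hlin ε hε.1 hε.2] at this
    simp only [pair_fin_two, Matrix.cons_val_zero, Matrix.cons_val_one] at this
    push_cast
    linarith
  obtain ⟨δ, hδ, hδmem⟩ := mem_nhdsGT_iff_exists_Ioo_subset.1 hev
  have hδ' : (0 : ℝ) < δ := hδ
  -- Two values of `ε` suffice: they separate the constant and linear parts in `ε`, and `hdet` makes
  -- the resulting system for `A`, `B` nonsingular.
  have e₁ : ((p 0 - q 0 - k : ℤ) : ℝ) * (a + δ / 2 * c) +
      ((p 1 - q 1 - l : ℤ) : ℝ) * (b + δ / 2 * d) = 0 := hδmem ⟨by linarith, by linarith⟩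
  have e₂ : ((p 0 - q 0 - k : ℤ) : ℝ) * (a + δ / 3 * c) +
      ((p 1 - q 1 - l : ℤ) : ℝ) * (b + δ / 3 * d) = 0 := hδmem ⟨by linarith, by linarith⟩
  set A := p 0 - q 0 - k with hA
  set B := p 1 - q 1 - l with hB
  have e₃ : (A : ℝ) * c + B * d = 0 := by
    have : δ * ((A : ℝ) * c + B * d) = 0 := by linarith
    exact (mul_eq_zero.1 this).resolve_left hδ'.ne'
  have e₄ : (A : ℝ) * a + B * b = 0 := by linarith
  have e₅ : A * c + B * d = 0 := by exact_mod_cast e₃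
  have e₆ : A * a + B * b = 0 := by exact_mod_cast e₄
  have hA0 : A = 0 := by
    have : A * (a * d - b * c) = 0 := by linear_combination d * e₆ - b * e₅
    exact (mul_eq_zero.1 this).resolve_right hdet
  have hB0 : B = 0 := by
    have : B * (a * d - b * c) = 0 := by linear_combination a * e₅ - c * e₆
    exact (mul_eq_zero.1 this).resolve_right hdet
  have hpq : p = q + ![k, l] := by
    ext m
    fin_cases m
    · simp; linarith
    · simp; linarith
  exact ⟨q, isCorner_of_eventually hq hqmax, hpq ▸ isCorner_of_eventually hp hpmax⟩

theorem minPolytope_subset {K : Set (Fin 3 → ℝ)} (hK : Convex ℝ K)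
    (h₁ : ![2, 0, 0] ∈ K) (h₂ : ![0, 2, 0] ∈ K) (h₃ : ![1, 0, 0] ∈ K) (h₄ : ![0, 1, 0] ∈ K)
    (h₅ : ![1, 1, 1] ∈ K) (h₆ : ![1, 0, 1] ∈ K) (h₇ : ![0, 1, 1] ∈ K) : minPolytope ⊆ K := by
  rw [minPolytope_eq]
  refine Set.union_subset (Set.union_subset ?_ (Set.union_subset ?_ ?_)) (Set.union_subset ?_ ?_) <;>
    exact tetra_subset hK ‹_› ‹_› ‹_› ‹_›

/-- Up to the translation by `i`, the exponents of `f` and `g` are those of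
`x² ⊕ xy ⊕ y² ⊕ x ⊕ y` and `xy ⊕ x ⊕ y`, except that `f` may lack the term `xy`. -/
structure IsMinSupport (f g : TropPoly 2) (i : Fin 2 → ℤ) : Prop where
  mem_denom : ∀ j ∈ g.coeff.support, j = i + ![1, 1] ∨ j = i + ![1, 0] ∨ j = i + ![0, 1]
  denom₁₁ : i + ![1, 1] ∈ g.coeff.support
  denom₁₀ : i + ![1, 0] ∈ g.coeff.support
  denom₀₁ : i + ![0, 1] ∈ g.coeff.support
  mem_numer : ∀ j ∈ f.coeff.support, j = i + ![2, 0] ∨ j = i + ![1, 1] ∨ j = i + ![0, 2] ∨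
    j = i + ![1, 0] ∨ j = i + ![0, 1]
  numer₂₀ : i + ![2, 0] ∈ f.coeff.support
  numer₀₂ : i + ![0, 2] ∈ f.coeff.support
  numer₁₀ : i + ![1, 0] ∈ f.coeff.support
  numer₀₁ : i + ![0, 1] ∈ f.coeff.support

/-- The possibly missing exponent of `xy` is the midpoint of those of `x²` and `y²`, so it does not
affect the polytope. -/
theorem IsMinSupport.vol_eq {f g : TropPoly 2} {i : Fin 2 → ℤ} (h : IsMinSupport f g i) :
    vol f g = 7 / 6 := by
  set v : Fin 3 → ℝ := ![(i 0 : ℝ), (i 1 : ℝ), 0] with hv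
  have hvadd : ∀ (a b : ℤ) (c : ℝ), ![(((i + ![a, b]) 0 : ℤ) : ℝ), (((i + ![a, b]) 1 : ℤ) : ℝ), c] =
      v + ![(a : ℝ), (b : ℝ), c] := by
    intro a b c
    simp [hv]
  have hnewt : newt (lift f + var (Fin.last 2) * lift g) = (fun x => v + x) '' minPolytope := by
    apply Set.Subset.antisymm
    · rw [newt_subset_iff (convex_minPolytope.translate v)]
      constructor
      · intro j hj
        rcases h.mem_numer j hj with rfl | rfl | rfl | rfl | rfl <;> rw [hvadd] <;>
          refine Set.mem_image_of_mem _ ?_ <;> simp [minPolytope] <;> norm_num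
      · intro j hj
        rcases h.mem_denom j hj with rfl | rfl | rfl <;> rw [hvadd] <;>
          refine Set.mem_image_of_mem _ ?_ <;> simp [minPolytope] <;> norm_num
    · obtain ⟨hN, hD⟩ := (newt_subset_iff (convex_newt _) f g).1 Set.Subset.rfl
      rw [Set.image_subset_iff]
      refine minPolytope_subset ((convex_newt _).translate_preimage_right v) ?_ ?_ ?_ ?_ ?_ ?_ ?_
      · simpa [hv] using hN _ h.numer₂₀
      · simpa [hv] using hN _ h.numer₀₂
      · simpa [hv] using hN _ h.numer₁₀
      · simpa [hv] using hN _ h.numer₀₁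
      · simpa [hv] using hD _ h.denom₁₁
      · simpa [hv] using hD _ h.denom₁₀
      · simpa [hv] using hD _ h.denom₀₁
  rw [vol, hnewt, measureReal_def, Set.image_add_left, measure_preimage_add, ← measureReal_def,
    volume_minPolytope]

/-! ### The dichotomy for Newton polytopes of expressions. -/

section Expression

variable {f g : TropPoly 2}

set_option maxHeartbeats 400000 in
theorem le_vol_or_exists_isMinSupport (hf : f ≠ 0) (hg : g ≠ 0)
    (hφ : ∀ t, realEval f t = realEval g t + ratio t) :
    4 / 3 ≤ vol f g ∨ ∃ i, IsMinSupport f g i := by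
  -- Each call takes a direction, a tie-break pointing into a cone of `φ`, and the slope of `φ` on
  -- that cone.
  have corner := exists_isCorner hf hg hφ
  obtain ⟨q₁, hq₁, hp₁⟩ := corner 1 0 0 1 1 (-1) (by norm_num) fun ε h₁ h₂ => by
    rw [ratio_of_nonneg_of_le] <;> simp <;> linarith
  obtain ⟨q₂, hq₂, hp₂⟩ := corner 1 0 0 (-1) 1 0 (by norm_num) fun ε h₁ h₂ => by
    rw [ratio_of_nonpos_right] <;> simp; linarith
  obtain ⟨q₃, hq₃, hp₃⟩ := corner 0 1 1 0 (-1) 1 (by norm_num) fun ε h₁ h₂ => by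
    rw [ratio_of_nonneg_of_ge] <;> simp <;> linarith
  obtain ⟨q₄, hq₄, hp₄⟩ := corner 0 1 (-1) 0 0 1 (by norm_num) fun ε h₁ h₂ => by
    rw [ratio_of_nonpos_left] <;> simp; linarith
  obtain ⟨q₅, hq₅, hp₅⟩ := corner 1 1 1 (-1) 1 (-1) (by norm_num) fun ε h₁ h₂ => by
    rw [ratio_of_nonneg_of_le] <;> simp <;> linarith
  obtain ⟨q₆, hq₆, hp₆⟩ := corner 1 1 (-1) 1 (-1) 1 (by norm_num) fun ε h₁ h₂ => by
    rw [ratio_of_nonneg_of_ge] <;> simp <;> linarith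
  obtain ⟨q₇, hq₇, hp₇⟩ := corner (-1) (-1) 1 (-1) 0 0 (by norm_num) fun ε h₁ h₂ => by
    rw [ratio_of_nonpos] <;> simp <;> linarith
  obtain ⟨q₈, hq₈, hp₈⟩ := corner (-1) (-1) (-1) 1 0 0 (by norm_num) fun ε h₁ h₂ => by
    rw [ratio_of_nonpos] <;> simp <;> linarith
  obtain ⟨q₉, hq₉, hp₉⟩ := corner (-1) 0 0 (-1) 0 0 (by norm_num) fun ε h₁ h₂ => by
    rw [ratio_of_nonpos] <;> simp; linarith
  obtain ⟨q₀, hq₀, hp₀⟩ := corner 0 (-1) (-1) 0 0 0 (by norm_num) fun ε h₁ h₂ => by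
    rw [ratio_of_nonpos] <;> simp; linarith
  -- The two corners of `f` in direction (1,0) come from slopes (1,-1) and (1,0), so `q₁` is at
  -- least one step above `q₂`; likewise `q₃` is at least one step right of `q₄`. Comparisons with
  -- `q₅` and `q₇` then give width at least 1 in direction (1,1).
  have e₁ := hp₁.2 _ hp₂.1
  have e₂ := hp₂.2 _ hp₁.1
  have e₃ := hp₃.2 _ hp₄.1
  have e₄ := hp₄.2 _ hp₃.1
  have e₅ := hq₅.2 _ hq₆.1
  have e₆ := hq₆.2 _ hq₅.1
  have e₇ := hq₅.2 _ hq₁.1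
  have e₈ := hq₅.2 _ hq₃.1
  have e₉ := hq₇.2 _ hq₂.1
  have e₁₀ := hq₇.2 _ hq₄.1
  have e₁₁ := hq₂.2 _ hq₇.1
  have e₁₂ := hq₈.2 _ hq₄.1
  have e₁₃ := hq₄.2 _ hq₈.1
  have e₁₄ := hq₇.2 _ hq₈.1
  have e₁₅ := hq₈.2 _ hq₇.1
  have e₁₆ := hq₁.2 _ hq₃.1
  simp only [Pi.add_apply, Matrix.cons_val_zero, Matrix.cons_val_one, one_mul, zero_mul, neg_mul,
    add_zero, zero_add] at e₁ e₂ e₃ e₄ e₅ e₆ e₇ e₈ e₉ e₁₀ e₁₁ e₁₂ e₁₃ e₁₄ e₁₅ e₁₆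
  obtain ⟨hN, hD⟩ := (newt_subset_iff (convex_newt _) f g).1 Set.Subset.rfl
  -- Width at least 2: the upper antidiagonal edge of `f` runs from `q₆ + (-1,1)` to `q₅ + (1,-1)`,
  -- of lattice length `q₅ 0 - q₆ 0 + 2 ≥ 2`, and `q₇` is an exponent of both `f` and `g`.
  by_cases hw : 2 ≤ q₅ 0 + q₅ 1 - (q₇ 0 + q₇ 1)
  · left
    have hl : q₅ 0 + q₅ 1 = q₆ 0 + q₆ 1 := by omega
    have hm : q₆ 0 ≤ q₅ 0 := by omega
    have hl' : (q₅ 0 : ℝ) + q₅ 1 = q₆ 0 + q₆ 1 := by exact_mod_cast hl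
    have hm' : (q₆ 0 : ℝ) ≤ q₅ 0 := by exact_mod_cast hm
    have hw' : (2 : ℝ) ≤ q₅ 0 + q₅ 1 - (q₇ 0 + q₇ 1) := by exact_mod_cast hw
    refine le_volume_of_width (convex_newt _) (isCompact_newt _)
      (a := q₆ 0 - 1) (b := q₆ 1 + 1) (c := q₅ 0) (d := q₅ 1) (e := q₇ 0) (f := q₇ 1)
      (w := q₅ 0 + q₅ 1 - (q₇ 0 + q₇ 1)) (m := q₅ 0 - q₆ 0 + 2) hw' (by linarith) (by linarith)
      (by linarith) ?_ ?_ ?_ ?_ ?_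
    · have h := hN _ hp₅.1
      have h₁ : (q₆ 0 : ℝ) - 1 + (q₅ 0 - q₆ 0 + 2) = q₅ 0 + 1 := by ring
      have h₂ : (q₆ 1 : ℝ) + 1 - (q₅ 0 - q₆ 0 + 2) = q₅ 1 - 1 := by linarith
      rw [h₁, h₂]
      simpa [sub_eq_add_neg] using h
    · simpa [sub_eq_add_neg] using hN _ hp₆.1
    · simpa using hN _ hp₇.1
    · exact hD _ hq₇.1
    · exact hD _ hq₅.1
  -- Width 1: now `q₁` and `q₃` lie on the upper antidiagonal and `q₇`, `q₈` on the lower one. With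
  -- `r = q₁ 0 - q₃ 0`, the edges of `g` have lattice lengths `r` and `r + 1`, those of `f` have `r
  -- + 2` and `r + 1`.
  by_cases hr : 1 ≤ q₁ 0 - q₃ 0
  · left
    have hr' : (1 : ℝ) ≤ q₁ 0 - q₃ 0 := by exact_mod_cast hr
    have k₁ : q₇ 0 = q₄ 0 + (q₁ 0 - q₃ 0) + 1 := by omega
    have k₂ : q₇ 1 = q₄ 1 - (q₁ 0 - q₃ 0) - 1 := by omega
    have k₃ : q₁ 0 + 1 = q₄ 0 + (q₁ 0 - q₃ 0) + 2 := by omega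
    have k₄ : q₁ 1 - 1 = q₄ 1 - (q₁ 0 - q₃ 0) - 1 := by omega
    have k₅ : q₃ 0 = q₄ 0 + 1 := by omega
    have k₆ : q₃ 1 = q₄ 1 := by omega
    have k₇ : q₈ 0 = q₄ 0 := by omega
    have k₈ : q₈ 1 = q₄ 1 := by omega
    refine le_volume_of_trapezoid (convex_newt _) (isCompact_newt _) (a := q₄ 0) (b := q₄ 1) hr'
      ?_ ?_ ?_ ?_ ?_ ?_
    · simpa [k₇, k₈] using hN _ hp₈.1
    · have h := hN _ hp₇.1
      simp only [Pi.add_apply, Matrix.cons_val_zero, Matrix.cons_val_one, add_zero, k₁, k₂] at h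
      exact_mod_cast h
    · have h := hN _ hp₁.1
      simp only [Pi.add_apply, Matrix.cons_val_zero, Matrix.cons_val_one, ← sub_eq_add_neg, k₃,
        k₄] at h
      exact_mod_cast h
    · simpa [k₅, k₆] using hN _ hp₃.1
    · exact hD _ hq₄.1
    · simpa [k₅, k₆] using hD _ hq₃.1
  -- Width 1 and `r = 0`: the inequalities determine the corners of `g` up to translation.
  right
  have c₂ : q₂ 0 = q₁ 0 ∧ q₂ 1 = q₁ 1 - 1 := by omega
  have c₃ : q₃ 0 = q₁ 0 ∧ q₃ 1 = q₁ 1 := by omega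
  have c₄ : q₄ 0 = q₁ 0 - 1 ∧ q₄ 1 = q₁ 1 := by omega
  have c₅ : q₅ 0 + q₅ 1 = q₁ 0 + q₁ 1 := by omega
  have c₇ : q₇ 0 = q₁ 0 ∧ q₇ 1 = q₁ 1 - 1 := by omega
  have c₈ : q₈ 0 = q₁ 0 - 1 ∧ q₈ 1 = q₁ 1 := by omega
  clear e₁ e₂ e₃ e₄ e₅ e₆ e₇ e₈ e₉ e₁₀ e₁₁ e₁₂ e₁₃ e₁₄ e₁₅ e₁₆ hw hr
  have eq_of : ∀ {j : Fin 2 → ℤ} {a b : ℤ}, j 0 = q₁ 0 - 1 + a → j 1 = q₁ 1 - 1 + b →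
      j = ![q₁ 0 - 1, q₁ 1 - 1] + ![a, b] := by
    intro j a b h₁ h₂
    ext k
    fin_cases k <;> simpa
  have hSmem : ∀ j ∈ g.coeff.support, q₁ 0 - 1 ≤ j 0 ∧ q₁ 1 - 1 ≤ j 1 ∧ j 0 ≤ q₁ 0 ∧ j 1 ≤ q₁ 1 ∧
      q₁ 0 + q₁ 1 - 1 ≤ j 0 + j 1 := by
    intro j hj
    have d₁ := (hq₁.2 j hj).1
    have d₂ := (hq₃.2 j hj).1
    have d₃ := (hq₇.2 j hj).1
    omega
  refine ⟨![q₁ 0 - 1, q₁ 1 - 1], ⟨fun j hj => ?_, ?_, ?_, ?_, fun j hj => ?_, ?_, ?_, ?_, ?_⟩⟩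
  · have h := hSmem j hj
    have : (j 0 = q₁ 0 - 1 + 1 ∧ j 1 = q₁ 1 - 1 + 1) ∨ (j 0 = q₁ 0 - 1 + 1 ∧ j 1 = q₁ 1 - 1 + 0) ∨
      (j 0 = q₁ 0 - 1 + 0 ∧ j 1 = q₁ 1 - 1 + 1) := by omega
    exact this.imp (fun h => eq_of h.1 h.2) (Or.imp (fun h => eq_of h.1 h.2) fun h => eq_of h.1 h.2)
  · rw [← eq_of (j := q₁) (by omega) (by omega)]
    exact hq₁.1
  · rw [← eq_of (j := q₂) (by omega) (by omega)]
    exact hq₂.1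
  · rw [← eq_of (j := q₄) (by omega) (by omega)]
    exact hq₄.1
  -- The slope of `φ` is zero at `q₉` and `q₀`, so `f` has the same lower bounds on each exponent as
  -- `g`; the antidiagonal bounds leave only five lattice points.
  · have d₁ := (hp₉.2 j hj).1
    have d₂ := (hp₀.2 j hj).1
    have d₃ := (hp₅.2 j hj).1
    have d₄ := (hp₇.2 j hj).1
    have d₅ := hSmem _ hq₉.1
    have d₆ := hSmem _ hq₀.1
    simp only [Pi.add_apply, Matrix.cons_val_zero, Matrix.cons_val_one] at d₁ d₂ d₃ d₄
    have : (j 0 = q₁ 0 - 1 + 2 ∧ j 1 = q₁ 1 - 1 + 0) ∨ (j 0 = q₁ 0 - 1 + 1 ∧ j 1 = q₁ 1 - 1 + 1) ∨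
      (j 0 = q₁ 0 - 1 + 0 ∧ j 1 = q₁ 1 - 1 + 2) ∨ (j 0 = q₁ 0 - 1 + 1 ∧ j 1 = q₁ 1 - 1 + 0) ∨
      (j 0 = q₁ 0 - 1 + 0 ∧ j 1 = q₁ 1 - 1 + 1) := by omega
    rcases this with h | h | h | h | h
    · exact Or.inl (eq_of h.1 h.2)
    · exact Or.inr (Or.inl (eq_of h.1 h.2))
    · exact Or.inr (Or.inr (Or.inl (eq_of h.1 h.2)))
    · exact Or.inr (Or.inr (Or.inr (Or.inl (eq_of h.1 h.2))))
    · exact Or.inr (Or.inr (Or.inr (Or.inr (eq_of h.1 h.2))))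
  · rw [← eq_of (j := q₁ + ![1, -1]) (by simp; omega) (by simp; omega)]
    exact hp₁.1
  · rw [← eq_of (j := q₃ + ![-1, 1]) (by simp; omega) (by simp; omega)]
    exact hp₃.1
  · rw [← eq_of (j := q₇ + ![0, 0]) (by simp; omega) (by simp; omega)]
    exact hp₇.1
  · rw [← eq_of (j := q₈ + ![0, 0]) (by simp; omega) (by simp; omega)]
    exact hp₈.1

end Expression

/-! ### Rigidity of the coefficients. -/

section Coefficients

variable {f g : TropPoly 2}

theorem IsMinSupport.coeff_eq {i : Fin 2 → ℤ} (h : IsMinSupport f g i) (hf : f ≠ 0) (hg : g ≠ 0)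
    (hφ : ∀ t, realEval f t = realEval g t + ratio t) (u : Fin 2 → ℝ) {p q : Fin 2 → ℤ}
    (hp : i + p ∈ f.coeff.support)
    (hpmax : ∀ k ∈ ({![2, 0], ![1, 1], ![0, 2], ![1, 0], ![0, 1]} : Finset (Fin 2 → ℤ)),
      k ≠ p → pair k u < pair p u)
    (hq : i + q ∈ g.coeff.support)
    (hqmax : ∀ k ∈ ({![1, 1], ![1, 0], ![0, 1]} : Finset (Fin 2 → ℤ)),
      k ≠ q → pair k u < pair q u)
    (hpq : pair p u = pair q u + ratio u) :
    toReal (f.coeff (i + p)) = toReal (g.coeff (i + q)) := by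
  have hlt : ∀ {k l : Fin 2 → ℤ}, i + k ≠ i + l → (k ≠ l → pair k u < pair l u) →
      pair (i + k) u < pair (i + l) u := by
    intro k l hne h
    rw [pair_add_left, pair_add_left]
    linarith [h (fun e => hne (by rw [e]))]
  refine coeff_eq_of_dominant hf hg hφ (fun s hs => ratio_smul hs u) hp (fun j hj hne => ?_) hq
    (fun j hj hne => ?_) (by rw [pair_add_left, pair_add_left, hpq]; ring)
  · rcases h.mem_numer j hj with rfl | rfl | rfl | rfl | rfl <;>
      exact hlt hne (hpmax _ (by simp))
  · rcases h.mem_denom j hj with rfl | rfl | rfl <;> exact hlt hne (hqmax _ (by simp))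

theorem IsMinSupport.exists_coeff {i : Fin 2 → ℤ} (h : IsMinSupport f g i) (hf : f ≠ 0)
    (hg : g ≠ 0) (hφ : ∀ t, realEval f t = realEval g t + ratio t) :
    ∃ C, toReal (f.coeff (i + ![2, 0])) = C ∧ toReal (f.coeff (i + ![0, 2])) = C ∧
      toReal (f.coeff (i + ![1, 0])) = C ∧ toReal (f.coeff (i + ![0, 1])) = C ∧
      (i + ![1, 1] ∈ f.coeff.support → toReal (f.coeff (i + ![1, 1])) ≤ C) := by
  -- The six directions lie inside cones of `φ` and single out one monomial of `f` and one of `g`.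
  -- The equalities link all outer coefficients through those of `g`.
  have e₁ := h.coeff_eq hf hg hφ ![2, 1] h.numer₂₀
    (by simp [pair_fin_two]; norm_num) h.denom₁₁ (by simp [pair_fin_two])
    (by rw [ratio_of_nonneg_of_le] <;> simp [pair_fin_two]; ring)
  have e₂ := h.coeff_eq hf hg hφ ![2, -1] h.numer₂₀
    (by simp [pair_fin_two]; norm_num) h.denom₁₀ (by simp [pair_fin_two]; norm_num)
    (by rw [ratio_of_nonpos_right] <;> simp [pair_fin_two]; ring)
  have e₃ := h.coeff_eq hf hg hφ ![1, 2] h.numer₀₂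
    (by simp [pair_fin_two]; norm_num) h.denom₁₁ (by simp [pair_fin_two])
    (by rw [ratio_of_nonneg_of_ge] <;> simp [pair_fin_two]; ring)
  have e₄ := h.coeff_eq hf hg hφ ![-1, 2] h.numer₀₂
    (by simp [pair_fin_two]; norm_num) h.denom₀₁ (by simp [pair_fin_two]; norm_num)
    (by rw [ratio_of_nonpos_left] <;> simp [pair_fin_two]; ring)
  have e₅ := h.coeff_eq hf hg hφ ![-1, -2] h.numer₁₀
    (by simp [pair_fin_two]; norm_num) h.denom₁₀ (by simp [pair_fin_two])
    (by rw [ratio_of_nonpos] <;> simp [pair_fin_two])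
  have e₆ := h.coeff_eq hf hg hφ ![-2, -1] h.numer₀₁
    (by simp [pair_fin_two]; norm_num) h.denom₀₁ (by simp [pair_fin_two])
    (by rw [ratio_of_nonpos] <;> simp [pair_fin_two])
  refine ⟨toReal (g.coeff (i + ![1, 1])), e₁, e₃, by linarith, by linarith, fun hmem => ?_⟩
  -- On the diagonal `φ` vanishes and `xy` dominates `g`, so the value of `g` there bounds the
  -- coefficient of `xy` in `f`. No equality can be expected, since `x²` and `y²` already attain the
  -- value of `xy`.
  have hev := eventually_realEval_eq (u := ![1, 1]) hg h.denom₁₁ fun j hj hne => by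
    rcases h.mem_denom j hj with rfl | rfl | rfl
    · exact absurd rfl hne
    · simp [pair_fin_two]
    · simp [pair_fin_two]
  obtain ⟨s, hs, hpos⟩ := (hev.and (eventually_gt_atTop 0)).exists
  have h₁ := hφ (s • ![1, 1])
  rw [hs, ratio_smul hpos, ratio_of_nonneg_of_le (by simp) (by simp)] at h₁
  have h₂ := (isMaxOf_realEval hf (s • ![1, 1])).1 _ hmem
  rw [h₁, monomialMap, pair_smul_right] at h₂
  simp only [Matrix.cons_val_zero, Matrix.cons_val_one, sub_self, mul_zero, add_zero] at h₂
  linarith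

/-- Whether or not `xy` occurs in `f`, its coefficient is at most `C`, so it cannot change the
maximum: `t 0 + t 1` is the mean of `2 * t 0` and `2 * t 1`. The formula for `g` follows by
subtracting `ratio`. -/
theorem IsMinSupport.exists_realEval_eq {i : Fin 2 → ℤ} (h : IsMinSupport f g i) (hf : f ≠ 0)
    (hg : g ≠ 0) (hφ : ∀ t, realEval f t = realEval g t + ratio t) :
    ∃ C, (∀ t, realEval f t = C + pair i t + numer t) ∧
      ∀ t, realEval g t = C + pair i t + denom t := by
  obtain ⟨C, h₂₀, h₀₂, h₁₀, h₀₁, h₁₁⟩ := h.exists_coeff hf hg hφ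
  have hnum : ∀ t, realEval f t = C + pair i t + numer t := by
    intro t
    obtain ⟨hle, j, hj, heq⟩ := isMaxOf_realEval hf t
    have m₁ := hle _ h.numer₂₀
    have m₂ := hle _ h.numer₀₂
    have m₃ := hle _ h.numer₁₀
    have m₄ := hle _ h.numer₀₁
    simp only [monomialMap, h₂₀, h₀₂, h₁₀, h₀₁, pair_add_left, pair_fin_two ![_, _],
      Matrix.cons_val_zero, Matrix.cons_val_one] at m₁ m₂ m₃ m₄
    push_cast at m₁ m₂ m₃ m₄
    apply le_antisymm
    · have n₁ : 2 * t 0 ≤ numer t := by simp [numer]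
      have n₂ : t 0 + t 1 ≤ numer t := by simp [numer]
      have n₃ : 2 * t 1 ≤ numer t := by simp [numer]
      have n₄ : t 0 ≤ numer t := by simp [numer]
      have n₅ : t 1 ≤ numer t := by simp [numer]
      rw [heq, monomialMap]
      rcases h.mem_numer j hj with rfl | rfl | rfl | rfl | rfl
      · rw [h₂₀, pair_add_left, pair_fin_two ![_, _]]
        simp only [Matrix.cons_val_zero, Matrix.cons_val_one]
        push_cast
        linarith
      · have := h₁₁ hj
        rw [pair_add_left, pair_fin_two ![_, _]]
        simp only [Matrix.cons_val_zero, Matrix.cons_val_one]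
        push_cast
        linarith
      · rw [h₀₂, pair_add_left, pair_fin_two ![_, _]]
        simp only [Matrix.cons_val_zero, Matrix.cons_val_one]
        push_cast
        linarith
      · rw [h₁₀, pair_add_left, pair_fin_two ![_, _]]
        simp only [Matrix.cons_val_zero, Matrix.cons_val_one]
        push_cast
        linarith
      · rw [h₀₁, pair_add_left, pair_fin_two ![_, _]]
        simp only [Matrix.cons_val_zero, Matrix.cons_val_one]
        push_cast
        linarith
    · have : numer t ≤ realEval f t - (C + pair i t) := by
        simp only [numer, max_le_iff]
        refine ⟨⟨⟨⟨?_, ?_⟩, ?_⟩, ?_⟩, ?_⟩ <;> linarith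
      linarith
  refine ⟨C, hnum, fun t => ?_⟩
  have h₁ := hφ t
  rw [hnum, ratio] at h₁
  linarith

end Coefficients

/-! ### Complexity bounds from break points and from explicit affine pieces. -/

section Factorizations

theorem not_isBalancedAt_of_forall {h : ℝ → ℝ} {x : ℝ}
    (H : ∀ ε : ℝ, 0 < ε → ε < 1 / 4 → h (x + ε) + h (x - ε) ≠ 2 * h x) : ¬ IsBalancedAt h x := by
  intro hb
  obtain ⟨ε, hε, h₁, h₂⟩ :=
    (Eventually.and hb (Ioo_mem_nhdsGT (show (0 : ℝ) < 1 / 4 by norm_num))).exists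
  exact H ε h₁ h₂ hε

variable {f : TropPoly 2} {i : Fin 2 → ℤ} {C : ℝ}

/-- The line `x + y = -1` crosses the regions of `x²`, `x`, `y`, `y²`, with slopes 2, 1, -1, -2, so
it sees three breaks; `xy` contributes none. -/
theorem numer_antidiagonal (s : ℝ) : (0 ≤ s → numer (![0, -1] + s • ![1, -1]) = 2 * s) ∧
    (-1 / 2 ≤ s → s ≤ 0 → numer (![0, -1] + s • ![1, -1]) = s) ∧
    (-1 ≤ s → s ≤ -1 / 2 → numer (![0, -1] + s • ![1, -1]) = -1 - s) ∧
    (s ≤ -1 → numer (![0, -1] + s • ![1, -1]) = -2 - 2 * s) := by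
  simp only [numer, Pi.add_apply, Pi.smul_apply, Matrix.cons_val_zero, Matrix.cons_val_one,
    smul_eq_mul]
  refine ⟨fun h => ?_, fun h h' => ?_, fun h h' => ?_, fun h => ?_⟩ <;> simp only [max_def] <;>
    split_ifs <;> linarith

theorem four_le_fComp (hf : f ≠ 0) (h : ∀ t, realEval f t = C + pair i t + numer t)
    {L : List (TropPoly 2)} (hL : IsFactorization f L) : 4 ≤ fComp L := by
  have key := card_lt_fComp hf hL ![0, -1] ![1, -1] {0, -1 / 2, -1} ?_
  · have hcard : ({0, -1 / 2, -1} : Finset ℝ).card = 3 := by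
      rw [Finset.card_eq_three]
      exact ⟨0, -1 / 2, -1, by norm_num, by norm_num, by norm_num, rfl⟩
    rw [hcard] at key
    exact key
  · intro x hx
    refine not_isBalancedAt_of_forall fun ε h₁ h₂ heq => ?_
    simp only [h, pair_add_right, pair_smul_right] at heq
    obtain ⟨a₁, a₂, a₃, a₄⟩ := numer_antidiagonal (x + ε)
    obtain ⟨b₁, b₂, b₃, b₄⟩ := numer_antidiagonal (x - ε)
    obtain ⟨c₁, c₂, c₃, c₄⟩ := numer_antidiagonal x
    simp only [Finset.mem_insert, Finset.mem_singleton] at hx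
    rcases hx with rfl | rfl | rfl
    · rw [a₁ (by linarith), b₂ (by linarith) (by linarith), c₁ le_rfl] at heq
      linarith
    · rw [a₂ (by linarith) (by linarith), b₃ (by linarith) (by linarith),
        c₂ le_rfl (by norm_num)] at heq
      linarith
    · rw [a₃ (by linarith) (by linarith), b₄ (by linarith), c₄ le_rfl] at heq
      linarith

theorem three_le_fComp (hf : f ≠ 0) (h : ∀ t, realEval f t = C + pair i t + denom t)
    {L : List (TropPoly 2)} (hL : IsFactorization f L) : 3 ≤ fComp L := by
  -- On the line `x + y = 1` the function is `max(1, s, 1 - s)`, breaking at 0 and 1.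
  have key := card_lt_fComp hf hL ![0, 1] ![1, -1] {0, 1} ?_
  · rw [Finset.card_pair (by norm_num)] at key
    exact key
  · intro x hx
    refine not_isBalancedAt_of_forall fun ε h₁ h₂ => ?_
    simp only [h, pair_fin_two, denom, Pi.add_apply, Pi.smul_apply, Matrix.cons_val_zero,
      Matrix.cons_val_one, smul_eq_mul]
    simp only [Finset.mem_insert, Finset.mem_singleton] at hx
    intro heq
    rcases hx with rfl | rfl <;> simp only [max_def] at heq <;> split_ifs at heq <;> linarith

/-- The coordinate function `t ↦ t_k` as an affine map. -/
def coord (k : Fin 2) : (Fin 2 → ℝ) →ᵃ[ℝ] ℝ := (LinearMap.proj k).toAffineMap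

theorem mComp_le_three (hf : f ≠ 0)
    (h : ∀ t, realEval f t = max (max (2 * t 0) (2 * t 1)) 0) : mComp f ≤ 3 := by
  refine mComp_le_card (E := Finset.univ)
    (l := ![(2 : ℝ) • coord 0, (2 : ℝ) • coord 1, (0 : (Fin 2 → ℝ) →ᵃ[ℝ] ℝ)]) hf fun t => ?_
  rw [h]
  refine ⟨fun k _ => ?_, ?_⟩
  · fin_cases k <;> simp [coord]
  · rcases max_choice (max (2 * t 0) (2 * t 1)) 0 with e | e
    · rcases max_choice (2 * t 0) (2 * t 1) with e' | e'
      · exact ⟨0, Finset.mem_univ _, by rw [e, e']; simp [coord]⟩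
      · exact ⟨1, Finset.mem_univ _, by rw [e, e']; simp [coord]⟩
    · exact ⟨2, Finset.mem_univ _, by rw [e]; simp⟩

theorem mComp_le_two (hf : f ≠ 0) (k : Fin 2) (h : ∀ t, realEval f t = max (t k) 0) :
    mComp f ≤ 2 := by
  refine mComp_le_card (E := Finset.univ)
    (l := ![coord k, (0 : (Fin 2 → ℝ) →ᵃ[ℝ] ℝ)]) hf fun t => ?_
  rw [h]
  refine ⟨fun m _ => ?_, ?_⟩
  · fin_cases m <;> simp [coord]
  · rcases max_choice (t k) 0 with e | e
    · exact ⟨0, Finset.mem_univ _, by rw [e]; simp [coord]⟩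
    · exact ⟨1, Finset.mem_univ _, by rw [e]; simp⟩

end Factorizations

/-! ### The two explicit expressions of `φ`. -/

theorem mem_support_single {n : ℕ} (i j : Fin n → ℤ) :
    j ∈ (AddMonoidAlgebra.single i (1 : Trop) : TropPoly n).coeff.support ↔ j = i := by
  classical
  rw [AddMonoidAlgebra.coeff_single, Finsupp.support_single _ one_ne_zero,
    Finset.mem_singleton]

theorem isMinSupport_zero :
    IsMinSupport ((var 0 : TropPoly 2) ^ 2 + var 0 * var 1 + var 1 ^ 2 + var 0 + var 1)
      (var 0 * var 1 + var 0 + var 1) 0 := by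
  have h₀ : (Pi.single 0 1 : Fin 2 → ℤ) = ![1, 0] := by ext k; fin_cases k <;> rfl
  have h₁ : (Pi.single 1 1 : Fin 2 → ℤ) = ![0, 1] := by ext k; fin_cases k <;> rfl
  constructor <;>
    simp only [var, h₀, h₁, pow_two, AddMonoidAlgebra.single_mul_single, mul_one, mem_support_add,
      mem_support_single, zero_add] <;> simp <;> tauto

section Evaluation

variable (t : Fin 2 → ℝ)

theorem eval_numer : eval ((var 0 : TropPoly 2) ^ 2 + var 0 * var 1 + var 1 ^ 2 + var 0 + var 1) t =
    ofReal (numer t) := by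
  simp only [eval_add, eval_mul, eval_var, pow_two, ofReal_mul_ofReal, ofReal_add_ofReal,
    numer, two_mul]

theorem eval_denom : eval ((var 0 : TropPoly 2) * var 1 + var 0 + var 1) t = ofReal (denom t) := by
  simp only [eval_add, eval_mul, eval_var, ofReal_mul_ofReal, ofReal_add_ofReal, denom]

/-- Once the constant 0 is present, `x`, `y` and `xy` are means of two of `2x`, `2y`, `0` and become
redundant. -/
theorem eval_numer_add_one :
    eval ((var 0 : TropPoly 2) ^ 2 + var 0 * var 1 + var 1 ^ 2 + var 0 + var 1 + 1) t =
      ofReal (max (max (2 * t 0) (2 * t 1)) 0) := by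
  rw [eval_add, eval_numer, eval_one, ofReal_add_ofReal]
  congr 1
  simp only [numer, max_def]
  split_ifs <;> linarith

theorem eval_var_add_one (k : Fin 2) : eval (var k + 1 : TropPoly 2) t = ofReal (max (t k) 0) := by
  rw [eval_add, eval_var, eval_one, ofReal_add_ofReal]

end Evaluation

theorem ratio_eq (t : Fin 2 → ℝ) :
    ratio t = max (max (2 * t 0) (2 * t 1)) 0 - (max (t 0) 0 + max (t 1) 0) := by
  simp only [ratio, numer, denom, max_def]
  split_ifs <;> linarith

theorem IsExpression.realEval_eq {φ : (Fin 2 → ℝ) → Trop} (hφ : ∀ t, φ t = ofReal (ratio t))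
    {f g : TropPoly 2} (h : IsExpression φ f g) :
    f ≠ 0 ∧ ∀ t, realEval f t = realEval g t + ratio t := by
  obtain ⟨hg, hq⟩ := h
  have hq' : ∀ t, ofReal (ratio t) = eval f t / ofReal (realEval g t) := fun t => by
    rw [← hφ, hq, quot, eval_eq_ofReal hg]
  have hf : f ≠ 0 := by
    rintro rfl
    have := hq' 0
    rw [eval_zero, zero_div_ofReal] at this
    exact ofReal_ne_zero _ this
  refine ⟨hf, fun t => ?_⟩
  have := hq' t
  rw [eval_eq_ofReal hf, ofReal_div_ofReal] at this
  linarith [ofReal_injective this]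

end TropRat

end

open TropRat in
theorem mainTheorem5 (x y f₁ g₁ f₂ : TropPoly 2) (φ : (Fin 2 → ℝ) → Trop)
    (hx : x = var 0) (hy : y = var 1)
    (hf₁ : f₁ = x ^ 2 + x * y + y ^ 2 + x + y) (hg₁ : g₁ = x * y + x + y)
    (hf₂ : f₂ = x ^ 2 + x * y + y ^ 2 + x + y + 1)
    (hφ : φ = quot f₁ g₁) :
    -- `f₁ ⊘ g₁` is a minimum volume expression of `φ`, of volume `7/6`
    IsMinVolExpression φ f₁ g₁ ∧ vol f₁ g₁ = 7 / 6 ∧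
    -- it is the only one, as functions and up to a common monomial `c x^i`, `c ≠ -∞`
    (∀ f g : TropPoly 2, IsMinVolExpression φ f g →
      ∃ (i : Fin 2 → ℤ) (c : Trop), c ≠ 0 ∧
        eval f = eval (AddMonoidAlgebra.single i c * f₁) ∧
        eval g = eval (AddMonoidAlgebra.single i c * g₁)) ∧
    -- `f₂ ⊘ ((x ⊕ 0) ⊙ (y ⊕ 0))` is an expression of `φ` whose factorization complexity is strictly
    -- smaller than that of any factorization of a minimum volume expression
    IsExpression φ [f₂].prod [x + 1, y + 1].prod ∧
    ∀ f g : TropPoly 2, IsMinVolExpression φ f g →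
      ∀ L M : List (TropPoly 2), IsFactorization f L → IsFactorization g M →
        FCompLT ([f₂], [x + 1, y + 1]) (L, M) := by
  subst hx hy
  have ef₁ : ∀ t, eval f₁ t = ofReal (numer t) := fun t => by rw [hf₁, eval_numer]
  have eg₁ : ∀ t, eval g₁ t = ofReal (denom t) := fun t => by rw [hg₁, eval_denom]
  have ef₂ : ∀ t, eval f₂ t = ofReal (max (max (2 * t 0) (2 * t 1)) 0) := fun t => by
    rw [hf₂, eval_numer_add_one]
  have ne_zero : ∀ {p : TropPoly 2} {F : (Fin 2 → ℝ) → ℝ}, (∀ t, eval p t = ofReal (F t)) →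
      p ≠ 0 := fun h => ne_zero_of_eval_ne_zero (t := 0) (h 0 ▸ ofReal_ne_zero _)
  have hφ' : ∀ t, φ t = ofReal (ratio t) := fun t => by
    rw [hφ, quot, ef₁, eg₁, ofReal_div_ofReal, ratio]
  have hexp₁ : IsExpression φ f₁ g₁ := ⟨ne_zero eg₁, hφ⟩
  have hdich : ∀ f g : TropPoly 2, IsExpression φ f g → 4 / 3 ≤ vol f g ∨
      vol f g = 7 / 6 ∧ ∃ (i : Fin 2 → ℤ) (C : ℝ), (∀ t, realEval f t = C + pair i t + numer t) ∧
        ∀ t, realEval g t = C + pair i t + denom t := by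
    intro f g h
    obtain ⟨hf, hfg⟩ := h.realEval_eq hφ'
    refine (le_vol_or_exists_isMinSupport hf h.1 hfg).imp_right ?_
    rintro ⟨i, hi⟩
    exact ⟨hi.vol_eq, i, hi.exists_realEval_eq hf h.1 hfg⟩
  have hvol₁ : vol f₁ g₁ = 7 / 6 := by
    rw [hf₁, hg₁, isMinSupport_zero.vol_eq]
  have hstruct : ∀ f g : TropPoly 2, IsMinVolExpression φ f g → ∃ (i : Fin 2 → ℤ) (C : ℝ),
      (∀ t, realEval f t = C + pair i t + numer t) ∧
        ∀ t, realEval g t = C + pair i t + denom t := by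
    intro f g h
    have hle := h.2 f₁ g₁ hexp₁
    rcases hdich f g h.1 with h' | h'
    -- Minimality gives volume at most 7/6, which excludes 4/3.
    · linarith
    · exact h'.2
  refine ⟨⟨hexp₁, fun f g h => ?_⟩, hvol₁, fun f g h => ?_, ?_, fun f g h L M hL hM => ?_⟩
  · rcases hdich f g h with h' | ⟨h', -⟩ <;> linarith
  · obtain ⟨i, C, hf, hg⟩ := hstruct f g h
    refine ⟨i, ofReal C, ofReal_ne_zero C, funext fun t => ?_, funext fun t => ?_⟩
    · rw [eval_eq_ofReal (h.1.realEval_eq hφ').1, hf, eval_mul, eval_single, ef₁, ofReal_mul_ofReal,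
        ofReal_mul_ofReal]
    · rw [eval_eq_ofReal h.1.1, hg, eval_mul, eval_single, eg₁, ofReal_mul_ofReal,
        ofReal_mul_ofReal]
  · have eg₂ : ∀ t, eval [(var 0 + 1 : TropPoly 2), var 1 + 1].prod t =
        ofReal (max (t 0) 0 + max (t 1) 0) := fun t => by
      rw [List.prod_cons, List.prod_singleton, eval_mul, eval_var_add_one, eval_var_add_one,
        ofReal_mul_ofReal]
    refine ⟨ne_zero eg₂, funext fun t => ?_⟩
    rw [hφ', quot, List.prod_singleton, ef₂, eg₂, ofReal_div_ofReal, ratio_eq]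
  · obtain ⟨i, C, hf, hg⟩ := hstruct f g h
    have h₁ := four_le_fComp (h.1.realEval_eq hφ').1 hf hL
    have h₂ := three_le_fComp h.1.1 hg hM
    have m₁ := mComp_le_three (ne_zero ef₂) fun t => realEval_eq_of_eval_eq (ef₂ t)
    have m₂ := mComp_le_two (ne_zero fun t => eval_var_add_one t 0) 0 fun t =>
      realEval_eq_of_eval_eq (eval_var_add_one t 0)
    have m₃ := mComp_le_two (ne_zero fun t => eval_var_add_one t 1) 1 fun t =>
      realEval_eq_of_eval_eq (eval_var_add_one t 1)
    have b₁ : fComp [f₂] ≤ 3 := by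
      simp only [fComp, List.map_cons, List.map_nil, List.sum_cons, List.sum_nil, List.length_cons,
        List.length_nil]
      push_cast
      linarith
    have b₂ : fComp [(var 0 + 1 : TropPoly 2), var 1 + 1] ≤ 3 := by
      simp only [fComp, List.map_cons, List.map_nil, List.sum_cons, List.sum_nil, List.length_cons,
        List.length_nil]
      push_cast
      linarith
    -- Strictness comes from the numerator: at most 3 against at least 4.
    refine ⟨⟨by simp only; linarith, by simp only; linarith⟩, fun hle => ?_⟩
    have := hle.1
    simp only at this
    linarith
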